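/- Let $n,m\ge 0$, let $X\subset\mathbb{R}^n$ be a bounded open set with Lipschitz boundary (near each of its boundary points, in suitable Cartesian coordinates, $X$ is the set of points lying strictly above the graph of a Lipschitz function), and let $Y\subseteq\mathbb{R}^m$. Let $u\in W^{1,\infty}(X;\mathbb{R}^m)$ satisfy $u(x)\in Y$ for a.e. $x\in X$, let $Du=(\partial_{x_j}u_i)_{ij}$ be its weak Jacobian, and let $v\in L^\infty(X;\mathbb{R}^{m\times n})$. Then $v=Du$ a.e. on $X$ if and only if \[ \int_X \Big\{ \nabla_x\cdot\theta(x,u(x)) + \operatorname{tr}\big[v(x)\,D_y\theta(x,u(x))\big]\Big\}\,dx-\int_{\partial X}\theta(x,u(x))\cdot\hat n(x)\,d\sigma(x)=0 \qquad\text{for all }\theta\in C^1(\overline X\times\overline Y;\mathbb{R}^n). \] Here $\theta=\theta(x,y)$, $\nabla_x\cdot\theta=\sum_{i=1}^n\partial_{x_i}\theta_i$ is its divergence in $x$, $D_y\theta=(\partial_{y_j}\theta_i)_{i\le n,\,j\le m}$ is its Jacobian matrix in $y$, $\hat n$ is the outward unit normal (defined $\sigma$-a.e. on $\partial X$), $\sigma$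 is the surface measure, that is, the $(n-1)$-dimensional Hausdorff measure on $\partial X$, and on $\partial X$ the function $u$ is understood through its trace, $u(x)=\lim_{r\to0}\frac{1}{|X\cap B(x,r)|}\int_{X\cap B(x,r)}u(y)\,dy$. A map $\theta$ belongs to $C^1(\overline X\times\overline Y;\mathbb{R}^n)$ if at every point of $\overline X\times\overline Y$ it is differentiable relative to $\overline X\times\overline Y$, with a derivative that can be chosen to depend continuously on the point; if $\overline Y$ is so thin that this derivative is not unique, the identity is required for every continuous choice of it. -/

import Mathlib

open MeasureTheory Set Filter
open scoped Topology NNReal ENNReal ContDiff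

/-- `X` has Lipschitz boundary: near every boundary point, in suitable Cartesian coordinates
`x = x' + t e` with `‖e‖ = 1` and `x' ⊥ e`, the set `X` is the strict epigraph `t > γ x'` of a
Lipschitz function `γ` (so `X` lies on one side of its boundary, the graph of `γ`). -/
def HasLipschitzBoundary {n : ℕ} (X : Set (EuclideanSpace ℝ (Fin n))) : Prop :=
  ∀ p ∈ frontier X, ∃ e : EuclideanSpace ℝ (Fin n), ‖e‖ = 1 ∧
    ∃ (γ : ↥(Submodule.span ℝ {e})ᗮ → ℝ) (K : ℝ≥0), LipschitzWith K γ ∧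
      ∃ r > 0, ∀ x ∈ Metric.ball p r,
        (x ∈ X ↔ γ ((Submodule.span ℝ {e})ᗮ.orthogonalProjectionOnto x) < inner ℝ e x)

/-- `ν` is an outward unit normal to `X` at `x`: up to directions that make an arbitrarily small
angle with the hyperplane orthogonal to `ν`, the set `X` near `x` is the half-space
`⟪y - x, ν⟫ < 0`. There is at most one such `ν`. Where the boundary is a graph `t = γ x'` with `X`
above it and `γ` is differentiable, it is the normalization of `∇γ - e`. -/
def IsOutwardUnitNormal {n : ℕ} (X : Set (EuclideanSpace ℝ (Fin n)))
    (x ν : EuclideanSpace ℝ (Fin n)) : Prop :=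
  ‖ν‖ = 1 ∧ ∀ ε > 0, ∃ r > 0, ∀ y ∈ Metric.ball x r,
    (ε * ‖y - x‖ < inner ℝ (y - x) ν → y ∉ X) ∧
    (inner ℝ (y - x) ν < -(ε * ‖y - x‖) → y ∈ X)

/-- The outward unit normal to `X` at `x` (arbitrary where there is none). -/
noncomputable def outwardUnitNormal {n : ℕ} (X : Set (EuclideanSpace ℝ (Fin n)))
    (x : EuclideanSpace ℝ (Fin n)) : EuclideanSpace ℝ (Fin n) :=
  Classical.epsilon fun ν => IsOutwardUnitNormal X x ν

/-- The surface measure on the boundary of `X`: the `(n-1)`-dimensional Hausdorff measure,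
normalized to agree with Lebesgue measure on `(n-1)`-dimensional Euclidean spaces. -/
noncomputable def surfaceMeasure {n : ℕ} (X : Set (EuclideanSpace ℝ (Fin n))) :
    Measure (EuclideanSpace ℝ (Fin n)) :=
  (Measure.euclideanHausdorffMeasure (n - 1)).restrict (frontier X)

/-- `D` is a weak Jacobian of `u` on `X`: `D x i j` is the weak derivative of the `i`-th component
of `u` with respect to the `j`-th coordinate. -/
def HasWeakJacobian {n m : ℕ} (X : Set (EuclideanSpace ℝ (Fin n)))
    (u : EuclideanSpace ℝ (Fin n) → EuclideanSpace ℝ (Fin m))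
    (D : EuclideanSpace ℝ (Fin n) → Matrix (Fin m) (Fin n) ℝ) : Prop :=
  LocallyIntegrableOn u X ∧ ∀ i j, LocallyIntegrableOn (fun x => D x i j) X ∧
    ∀ φ : EuclideanSpace ℝ (Fin n) → ℝ, ContDiff ℝ ∞ φ → HasCompactSupport φ → tsupport φ ⊆ X →
      (∫ x in X, u x i * fderiv ℝ φ x (EuclideanSpace.single j 1)) = -(∫ x in X, D x i j * φ x)

/-- The weak Jacobian matrix `Du` (unique up to null sets; arbitrary if there is none). -/
noncomputable def weakJacobian {n m : ℕ} (X : Set (EuclideanSpace ℝ (Fin n)))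
    (u : EuclideanSpace ℝ (Fin n) → EuclideanSpace ℝ (Fin m)) :
    EuclideanSpace ℝ (Fin n) → Matrix (Fin m) (Fin n) ℝ :=
  Classical.epsilon fun D => HasWeakJacobian X u D

/-- `v ∈ L^∞(X; ℝ^{m×n})`. -/
def MemLInfMatrix {n m : ℕ} (X : Set (EuclideanSpace ℝ (Fin n)))
    (v : EuclideanSpace ℝ (Fin n) → Matrix (Fin m) (Fin n) ℝ) : Prop :=
  ∀ i j, MemLp (fun x => v x i j) ∞ (volume.restrict X)

/-- `u ∈ W^{1,∞}(X; ℝ^m)`: `u` is essentially bounded and weakly differentiable with essentially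
bounded weak Jacobian. -/
def MemW1Inf {n m : ℕ} (X : Set (EuclideanSpace ℝ (Fin n)))
    (u : EuclideanSpace ℝ (Fin n) → EuclideanSpace ℝ (Fin m)) : Prop :=
  MemLp u ∞ (volume.restrict X) ∧ ∃ D, HasWeakJacobian X u D ∧ MemLInfMatrix X D

/-- The boundary values (trace) of `u`: the limit of the means of `u` over `X ∩ B(x, r)` as
`r → 0`. It is the value at `x` of the continuous extension of `u` to the closure of `X`, when
`u` agrees almost everywhere with a function that has one. -/
noncomputable def boundaryTrace {n m : ℕ} (X : Set (EuclideanSpace ℝ (Fin n)))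
    (u : EuclideanSpace ℝ (Fin n) → EuclideanSpace ℝ (Fin m)) (x : EuclideanSpace ℝ (Fin n)) :
    EuclideanSpace ℝ (Fin m) :=
  limUnder (𝓝[>] (0 : ℝ)) fun r => ⨍ y in X ∩ Metric.ball x r, u y

/-- `f` is continuously differentiable on the set `s`, with derivative `f'`. The derivative is
taken within `s`, and is determined by `f` if, for instance, `s` is the closure of its interior
and convex; on thin sets any continuous derivative within `s` is admitted. -/
structure IsC1On {E F : Type*} [NormedAddCommGroup E] [NormedSpace ℝ E] [NormedAddCommGroup F]
    [NormedSpace ℝ F] (s : Set E) (f : E → F) (f' : E → E →L[ℝ] F) : Prop where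
  hasFDerivWithinAt : ∀ p ∈ s, HasFDerivWithinAt f (f' p) s p
  continuousOn_deriv : ContinuousOn f' s

/-- The divergence in the `x` variables, `∇ₓ · θ`, read off the full derivative `θ'` of
`θ(x, y)` at a point. -/
noncomputable def divX {n m : ℕ}
    (A : EuclideanSpace ℝ (Fin n) × EuclideanSpace ℝ (Fin m) →L[ℝ] EuclideanSpace ℝ (Fin n)) : ℝ :=
  ∑ i, A (EuclideanSpace.single i 1, 0) i

/-- The `n × m` Jacobian matrix in the `y` variables, `(∂θ_i/∂y_j)_{ij}`, read off the full
derivative `θ'` of `θ(x, y)` at a point. -/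
noncomputable def jacY {n m : ℕ}
    (A : EuclideanSpace ℝ (Fin n) × EuclideanSpace ℝ (Fin m) →L[ℝ] EuclideanSpace ℝ (Fin n)) :
    Matrix (Fin n) (Fin m) ℝ :=
  Matrix.of fun i j => A (0, EuclideanSpace.single j 1) i

/-!
The identity is the divergence theorem for the vector field `x ↦ θ (x, u x)`, whose divergence is
given by the chain rule; the difficulty is that nothing in sight is smooth.

A function `u` in `W^{1,∞}` agrees almost everywhere with a function `w` that is Lipschitz along
every segment contained in `X`: the mollifications of `u` have bounded gradients wherever the kernel
stays inside `X`, and they converge at almost every point. In a boundary chart any two points are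
joined by a path of comparable length made of three segments, so `w` is Lipschitz near every point
of the closure of `X` and extends continuously to it (`MemW1Inf.exists_representative`). Its boundary
values are the trace of `u` (`boundaryTrace_eq`), its values on the closure of `X` belong to the
closure of `Y`, and its classical Jacobian, which exists almost everywhere by Rademacher's theorem,
is the weak Jacobian (`HasWeakJacobian.ae_eq_fderiv`).

The test function `θ` is only differentiable relative to `closure X ×ˢ closure Y`, which may be thin,
and it need not be Lipschitz there. Still, along a segment the difference quotients of
`t ↦ θ (c t, w (c t))` are bounded close to each point, by the derivative of `θ` on the compact graph
of `w`. Hence `x ↦ θ (x, w x)` is again Lipschitz along segments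
(`IsC1On.lipschitzAlongSegments`), and the chain rule computes its derivative wherever `w` is
differentiable.

It remains to prove the divergence theorem for functions that are continuous on the closure of a
bounded Lipschitz domain and Lipschitz along its segments
(`integral_fderiv_eq_integral_surfaceMeasure`). A smooth partition of unity reduces it to compactly
supported Lipschitz functions `G`, on the whole space or above the graph of a Lipschitz function `γ`.
Above a graph, the integral of a directional derivative of `G` is the limit of integrals of
difference quotients; moving the translation from `G` to the epigraph turns these into integrals
over the thin region between the graph and a translate of it, and dominated convergence yields an
integral over the base of the graph (`integral_strictEpigraph_fderiv`). It equals the surface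
integral because of the formula for the normal (`sqrt_mul_inner_outwardUnitNormal`) and the area
formula for Lipschitz graphs (`restrict_range_graphMap`). The latter is proved by comparing Hausdorff
measures on countably many pieces on which `γ` is almost linear.

Conversely, the identity for `θ (x, y) = φ x * y i • e j`, with `φ` smooth and compactly supported
in `X`, says that `v i j` is the weak derivative of `u i` in the direction `j`, and weak Jacobians are
unique almost everywhere.
-/

/-! ### The area formula for Lipschitz graphs -/

section GraphArea

variable {E : Type*} [NormedAddCommGroup E] [InnerProductSpace ℝ E]

/-- The hyperplane through the origin orthogonal to `e`. -/
noncomputable abbrev hyperplane (e : E) : Submodule ℝ E := (Submodule.span ℝ {e})ᗮ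

/-- The parametrization `x ↦ x + γ x • e` of the graph of `γ` over the hyperplane orthogonal
to `e`. -/
noncomputable def graphMap (e : E) (γ : hyperplane e → ℝ) (x : hyperplane e) : E := (x : E) + γ x • e

variable {e : E} {γ : hyperplane e → ℝ}

lemma inner_coe_hyperplane (x : hyperplane e) : inner ℝ e (x : E) = 0 :=
  (Submodule.mem_orthogonal_singleton_iff_inner_right.1 x.2)

lemma norm_coe_add_smul_sq (he : ‖e‖ = 1) (x : hyperplane e) (t : ℝ) :
    ‖(x : E) + t • e‖ ^ 2 = ‖x‖ ^ 2 + t ^ 2 := by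
  have h : inner ℝ (x : E) (t • e) = 0 := by
    rw [inner_smul_right, real_inner_comm, inner_coe_hyperplane, mul_zero]
  have := norm_add_sq_eq_norm_sq_add_norm_sq_of_inner_eq_zero _ _ h
  rw [pow_two, this, norm_smul, he]
  simp only [Submodule.coe_norm, Real.norm_eq_abs, mul_one, abs_mul_abs_self]
  ring

lemma inner_coe_add_smul (he : ‖e‖ = 1) (x : hyperplane e) (t : ℝ) :
    inner ℝ e ((x : E) + t • e) = t := by
  rw [inner_add_right, inner_coe_hyperplane, inner_smul_right, real_inner_self_eq_norm_sq, he]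
  norm_num

lemma norm_le_norm_coe_add_smul (he : ‖e‖ = 1) (x : hyperplane e) (t : ℝ) :
    ‖x‖ ≤ ‖(x : E) + t • e‖ := by
  refine le_of_sq_le_sq ?_ (norm_nonneg _)
  rw [norm_coe_add_smul_sq he]
  nlinarith [sq_nonneg t]

lemma dist_graphMap (x y : hyperplane e) :
    dist (graphMap e γ x) (graphMap e γ y) = ‖((x - y : hyperplane e) : E) + (γ x - γ y) • e‖ := by
  rw [dist_eq_norm]
  congr 1
  simp only [graphMap, Submodule.coe_sub, sub_smul]
  abel

/-- Changing the height of `x + t • e` by at most `c * ‖x‖` changes its norm by a factor of at most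
`1 + c`. -/
lemma norm_coe_add_smul_le (he : ‖e‖ = 1) (x : hyperplane e) {s t c : ℝ} (hc : 0 ≤ c)
    (h : |s - t| ≤ c * ‖x‖) : ‖(x : E) + s • e‖ ≤ (1 + c) * ‖(x : E) + t • e‖ := by
  have h1 : (x : E) + s • e = ((x : E) + t • e) + (s - t) • e := by
    rw [sub_smul]; abel
  have h2 : ‖(s - t) • e‖ ≤ c * ‖x‖ := by rw [norm_smul, he, mul_one]; exact h
  calc ‖(x : E) + s • e‖ ≤ ‖(x : E) + t • e‖ + ‖(s - t) • e‖ := by rw [h1]; exact norm_add_le _ _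
    _ ≤ ‖(x : E) + t • e‖ + c * ‖(x : E) + t • e‖ := by
        gcongr
        exact h2.trans (by gcongr; exact norm_le_norm_coe_add_smul he x t)
    _ = _ := by ring

lemma continuous_graphMap (hγ : Continuous γ) : Continuous (graphMap e γ) := by
  unfold graphMap
  fun_prop

lemma injective_graphMap (he : ‖e‖ = 1) : Function.Injective (graphMap e γ) := by
  intro x y h
  have h1 := dist_graphMap (γ := γ) x y
  rw [h, dist_self] at h1
  have h2 := norm_le_norm_coe_add_smul he (x - y) (γ x - γ y)
  rw [← h1] at h2
  exact sub_eq_zero.1 (norm_le_zero_iff.1 h2)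

lemma lipschitzWith_graphMap (he : ‖e‖ = 1) {K : ℝ≥0} (hγ : LipschitzWith K γ) :
    LipschitzWith (1 + K) (graphMap e γ) := by
  refine LipschitzWith.of_dist_le_mul fun x y => ?_
  rw [dist_graphMap]
  have h : |(γ x - γ y) - 0| ≤ (K : ℝ) * ‖x - y‖ := by
    simpa [Real.dist_eq, dist_eq_norm] using hγ.dist_le_mul x y
  have := norm_coe_add_smul_le he (x - y) K.2 h
  simpa [dist_eq_norm] using this

/-- The linear parametrization `x ↦ x + a x • e` of the graph of a linear form `a`. -/
noncomputable def graphLinear (e : E) (a : hyperplane e →L[ℝ] ℝ) : hyperplane e →ₗ[ℝ] E :=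
  (hyperplane e).subtype + (a : hyperplane e →ₗ[ℝ] ℝ).smulRight e

lemma graphLinear_apply (a : hyperplane e →L[ℝ] ℝ) (x : hyperplane e) :
    graphLinear e a x = (x : E) + a x • e := by
  simp [graphLinear]

variable [FiniteDimensional ℝ E]

/-- The volume factor of a linear graph: the Gram matrix of the images of an orthonormal basis is
the identity plus a matrix of rank one. -/
lemma normDet_graphLinear (he : ‖e‖ = 1) (a : hyperplane e →L[ℝ] ℝ) :
    (graphLinear e a).normDet = √(1 + ‖a‖ ^ 2) := by
  let b := stdOrthonormalBasis ℝ (hyperplane e)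
  have h := (graphLinear e a).normDet_sq_eq_det_gram b
  have hG : Matrix.gram ℝ (fun i => graphLinear e a (b i)) =
      1 + Matrix.replicateCol Unit (fun i => a (b i)) *
        Matrix.replicateRow Unit (fun i => a (b i)) := by
    ext i j
    have h1 : inner ℝ ((b i : hyperplane e) : E) ((b j : hyperplane e) : E) =
        if i = j then (1 : ℝ) else 0 := by
      rw [← Submodule.coe_inner]
      exact orthonormal_iff_ite.1 b.orthonormal i j
    have h2 : inner ℝ ((b i : hyperplane e) : E) e = 0 := by
      rw [real_inner_comm, inner_coe_hyperplane]
    simp only [Matrix.gram_apply, graphLinear_apply, inner_add_left, inner_add_right, h1,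
      inner_smul_left, inner_smul_right, h2, inner_coe_hyperplane, real_inner_self_eq_norm_sq, he,
      Matrix.add_apply, Matrix.one_apply, Matrix.mul_apply, Matrix.replicateCol_apply,
      Matrix.replicateRow_apply]
    simp [mul_comm]
  rw [hG, Matrix.det_one_add_replicateCol_mul_replicateRow] at h
  have h3 : (fun i => a (b i)) ⬝ᵥ (fun i => a (b i)) = ‖a‖ ^ 2 := by
    obtain ⟨z, rfl⟩ := (InnerProductSpace.toDual ℝ (hyperplane e)).surjective a
    rw [LinearIsometryEquiv.norm_map, ← b.sum_sq_norm_inner_right z]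
    simp only [dotProduct, InnerProductSpace.toDual_apply_apply, Real.norm_eq_abs, sq_abs]
    exact Finset.sum_congr rfl fun i _ => by rw [real_inner_comm]; ring
  rw [h3] at h
  rw [eq_comm, Real.sqrt_eq_iff_mul_self_eq (by positivity) (LinearMap.normDet_nonneg _)]
  have h' : (graphLinear e a).normDet ^ 2 = 1 + ‖a‖ ^ 2 := h
  rw [← h']; ring

lemma sqrt_one_add_sq_le {p q ε : ℝ} (hp : 0 ≤ p) (hq : 0 ≤ q) (hε : 0 ≤ ε) (h : p ≤ q + ε) :
    √(1 + p ^ 2) ≤ (1 + ε) * √(1 + q ^ 2) := by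
  have h1 : 1 ≤ √(1 + q ^ 2) := Real.one_le_sqrt.2 (by nlinarith)
  have h2 : q ≤ √(1 + q ^ 2) := Real.le_sqrt_of_sq_le (by linarith)
  rw [Real.sqrt_le_left (by positivity), mul_pow, Real.sq_sqrt (by positivity)]
  nlinarith [mul_nonneg hε hq, mul_nonneg hε hε, mul_nonneg (mul_nonneg hε hq) hq,
    mul_nonneg (mul_nonneg hε hε) (mul_nonneg hq hq), sq_nonneg (q - 1),
    mul_nonneg hε (sq_nonneg (q - 1)), pow_le_pow_left₀ hp h 2]

/-- If `g` does not expand distances on `T` by more than a factor `C` compared with `f`, then it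
does not expand `d`-dimensional measure by more than `C ^ d`. -/
lemma euclideanHausdorffMeasure_image_le_of_dist_le {α M N : Type*} [MetricSpace M]
    [MeasurableSpace M] [BorelSpace M] [MetricSpace N] [MeasurableSpace N] [BorelSpace N]
    {f : α → M} {g : α → N} {T : Set α} {C : ℝ≥0}
    (h : ∀ x ∈ T, ∀ y ∈ T, dist (g x) (g y) ≤ C * dist (f x) (f y)) (d : ℕ) :
    Measure.euclideanHausdorffMeasure d (g '' T) ≤
      (C : ℝ≥0∞) ^ d * Measure.euclideanHausdorffMeasure d (f '' T) := by
  rcases T.eq_empty_or_nonempty with rfl | ⟨x₀, hx₀⟩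
  · simp
  have : Nonempty α := ⟨x₀⟩
  have hr : ∀ x ∈ T, Function.invFunOn f T (f x) ∈ T ∧ f (Function.invFunOn f T (f x)) = f x :=
    fun x hx => ⟨Function.invFunOn_mem ⟨x, hx, rfl⟩, Function.invFunOn_eq ⟨x, hx, rfl⟩⟩
  have hL : LipschitzOnWith C (g ∘ Function.invFunOn f T) (f '' T) := by
    refine LipschitzOnWith.of_dist_le_mul ?_
    rintro _ ⟨x, hx, rfl⟩ _ ⟨y, hy, rfl⟩
    have := h _ (hr x hx).1 _ (hr y hy).1
    rwa [(hr x hx).2, (hr y hy).2] at this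
  have him : (g ∘ Function.invFunOn f T) '' (f '' T) = g '' T := by
    rw [image_image]
    refine image_congr fun x hx => ?_
    have := h _ (hr x hx).1 _ hx
    rw [(hr x hx).2, dist_self, mul_zero] at this
    exact dist_le_zero.1 this
  have := hL.hausdorffMeasure_image_le (d := d) (Nat.cast_nonneg d)
  rw [him] at this
  simp only [Measure.euclideanHausdorffMeasure_def, Measure.smul_apply, Measure.nnreal_smul_coe_apply]
  calc _ ≤ _ * ((C : ℝ≥0∞) ^ (d : ℝ) * _) := by gcongr
    _ = _ := by rw [ENNReal.rpow_natCast]; exact mul_left_comm _ _ _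

/-- A comparison of two measures on the subsets of each of countably many sets which carry the first
one extends to all measurable sets. -/
lemma measure_le_mul_of_forall_subset {α : Type*} [MeasurableSpace α] {μ ν : Measure α} {c : ℝ≥0∞}
    {S : ℕ → Set α} (hS : ∀ i, MeasurableSet (S i)) (hcov : μ (⋃ i, S i)ᶜ = 0)
    (h : ∀ i, ∀ T ⊆ S i, MeasurableSet T → μ T ≤ c * ν T) {A : Set α} (hA : MeasurableSet A) :
    μ A ≤ c * ν A := by
  have hd : ∀ i, MeasurableSet (disjointed S i) := MeasurableSet.disjointed hS
  have hdis : Pairwise (Function.onFun Disjoint fun i => A ∩ disjointed S i) := fun i j hij =>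
    (disjoint_disjointed S hij).mono inter_subset_right inter_subset_right
  calc μ A = μ (A ∩ ⋃ i, S i) := (measure_inter_conull hcov).symm
    _ = μ (⋃ i, A ∩ disjointed S i) := by rw [← iUnion_disjointed, inter_iUnion]
    _ = ∑' i, μ (A ∩ disjointed S i) := measure_iUnion hdis fun i => hA.inter (hd i)
    _ ≤ ∑' i, c * ν (A ∩ disjointed S i) := ENNReal.tsum_le_tsum fun i =>
        h i _ (inter_subset_right.trans (disjointed_subset S i)) (hA.inter (hd i))
    _ = c * ν (⋃ i, A ∩ disjointed S i) := by
        rw [ENNReal.tsum_mul_left, measure_iUnion hdis fun i => hA.inter (hd i)]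
    _ ≤ c * ν A := by
        gcongr
        exact iUnion_subset fun i => inter_subset_left

variable [MeasurableSpace E] [BorelSpace E]

/-- The area density of the graph of `γ`. -/
noncomputable def graphDensity (γ : hyperplane e → ℝ) (x : hyperplane e) : ℝ≥0∞ :=
  ENNReal.ofReal √(1 + ‖fderiv ℝ γ x‖ ^ 2)

omit [FiniteDimensional ℝ E] in
lemma measurable_graphDensity (γ : hyperplane e → ℝ) : Measurable (graphDensity γ) := by
  unfold graphDensity
  have h := (measurable_fderiv ℝ γ).norm
  fun_prop

/-- The area of a piece of graph over `T`, compared with the integral of the area density. -/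
lemma graph_area_piece (he : ‖e‖ = 1) {ε : ℝ≥0} {T : Set (hyperplane e)}
    (hT : MeasurableSet T) {a : hyperplane e →L[ℝ] ℝ} (ha : ApproximatesLinearOn γ a T ε)
    (hγ : ∀ x ∈ T, ‖fderiv ℝ γ x - a‖ ≤ ε) :
    Measure.euclideanHausdorffMeasure (Module.finrank ℝ (hyperplane e)) (graphMap e γ '' T) ≤
        (1 + ε : ℝ≥0) ^ (Module.finrank ℝ (hyperplane e) + 1) * ∫⁻ x in T, graphDensity γ x ∧
      ∫⁻ x in T, graphDensity γ x ≤ (1 + ε : ℝ≥0) ^ (Module.finrank ℝ (hyperplane e) + 1) *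
        Measure.euclideanHausdorffMeasure (Module.finrank ℝ (hyperplane e))
          (graphMap e γ '' T) := by
  set d := Module.finrank ℝ (hyperplane e)
  have hε : (0 : ℝ) ≤ ε := ε.2
  have hdl : ∀ x y, dist (graphLinear e a x) (graphLinear e a y) =
      ‖((x - y : hyperplane e) : E) + (a (x - y)) • e‖ := by
    intro x y
    rw [dist_eq_norm, ← map_sub, graphLinear_apply]
  have hap : ∀ x ∈ T, ∀ y ∈ T, |(γ x - γ y) - a (x - y)| ≤ ε * ‖x - y‖ := fun x hx y hy =>
    ha x hx y hy
  have h1 := euclideanHausdorffMeasure_image_le_of_dist_le (f := graphLinear e a)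
    (g := graphMap e γ) (T := T) (C := 1 + ε) (fun x hx y hy => by
      rw [hdl, dist_graphMap]
      exact norm_coe_add_smul_le he _ hε (hap x hx y hy)) d
  have h2 := euclideanHausdorffMeasure_image_le_of_dist_le (g := graphLinear e a)
    (f := graphMap e γ) (T := T) (C := 1 + ε) (fun x hx y hy => by
      rw [hdl, dist_graphMap]
      refine norm_coe_add_smul_le he _ hε ?_
      rw [abs_sub_comm]
      exact hap x hx y hy) d
  rw [LinearMap.euclideanHausdorffMeasure_image_eq_normDet_mul_volume, normDet_graphLinear he] at h1 h2
  have hC : ENNReal.ofReal (1 + ε) = ((1 + ε : ℝ≥0) : ℝ≥0∞) := by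
    rw [ENNReal.ofReal, Real.toNNReal_add zero_le_one hε]; simp
  have h3 : ENNReal.ofReal √(1 + ‖a‖ ^ 2) * volume T ≤
      (1 + ε : ℝ≥0) * ∫⁻ x in T, graphDensity γ x := by
    rw [← setLIntegral_const, ← lintegral_const_mul _ (measurable_graphDensity γ)]
    refine setLIntegral_mono' hT fun x hx => ?_
    rw [graphDensity, ← hC, ← ENNReal.ofReal_mul (by positivity)]
    refine ENNReal.ofReal_le_ofReal (sqrt_one_add_sq_le (by positivity) (by positivity) hε ?_)
    linarith [norm_sub_norm_le a (fderiv ℝ γ x), norm_sub_rev a (fderiv ℝ γ x), hγ x hx]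
  have h4 : ∫⁻ x in T, graphDensity γ x ≤
      (1 + ε : ℝ≥0) * (ENNReal.ofReal √(1 + ‖a‖ ^ 2) * volume T) := by
    rw [← setLIntegral_const, ← lintegral_const_mul _ measurable_const]
    refine setLIntegral_mono' hT fun x hx => ?_
    rw [graphDensity, ← hC, ← ENNReal.ofReal_mul (by positivity)]
    refine ENNReal.ofReal_le_ofReal (sqrt_one_add_sq_le (by positivity) (by positivity) hε ?_)
    linarith [norm_sub_norm_le (fderiv ℝ γ x) a, hγ x hx]
  constructor
  · refine h1.trans ?_
    rw [pow_succ (_ : ℝ≥0∞), mul_assoc]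
    gcongr
  · refine h4.trans ?_
    rw [pow_succ' (_ : ℝ≥0∞), mul_assoc]
    gcongr

/-- Countably many measurable sets on which a function is close to linear, and its derivative close
to the same linear map, cover the set of differentiability points. -/
lemma exists_cover_approximatesLinearOn (γ : hyperplane e → ℝ) {ε : ℝ≥0} (hε : ε ≠ 0) :
    ∃ (S : ℕ → Set (hyperplane e)) (a : ℕ → hyperplane e →L[ℝ] ℝ), (∀ i, MeasurableSet (S i)) ∧
      {x | DifferentiableAt ℝ γ x} ⊆ ⋃ i, S i ∧
      ∀ i, ApproximatesLinearOn γ (a i) (S i) ε ∧ ∀ x ∈ S i, ‖fderiv ℝ γ x - a i‖ ≤ ε := by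
  have hε' : (0 : ℝ) < ε := by positivity
  let c := TopologicalSpace.denseSeq (hyperplane e →L[ℝ] ℝ)
  let s : ℕ → Set (hyperplane e) := fun k =>
    {x | DifferentiableAt ℝ γ x} ∩ fderiv ℝ γ ⁻¹' Metric.ball (c k) (ε / 2)
  have hs : ∀ k, MeasurableSet (s k) := fun k =>
    (measurableSet_of_differentiableAt ℝ γ).inter (measurable_fderiv ℝ γ Metric.isOpen_ball.measurableSet)
  choose t A _ htm htc hta hA using fun k =>
    exists_partition_approximatesLinearOn_of_hasFDerivWithinAt γ (s k) (fderiv ℝ γ)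
      (fun x hx => hx.1.hasFDerivAt.hasFDerivWithinAt) (fun _ => ε) (fun _ => hε)
  refine ⟨fun i => s i.unpair.1 ∩ t i.unpair.1 i.unpair.2, fun i => A i.unpair.1 i.unpair.2,
    fun i => (hs _).inter (htm _ _), fun x hx => ?_, fun i => ⟨hta _ _, fun x hx => ?_⟩⟩
  · obtain ⟨k, hk⟩ := (TopologicalSpace.denseRange_denseSeq (hyperplane e →L[ℝ] ℝ)).exists_dist_lt
      (fderiv ℝ γ x) (half_pos hε')
    have hxs : x ∈ s k := ⟨hx, hk⟩
    obtain ⟨j, hj⟩ := mem_iUnion.1 (htc k hxs)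
    exact mem_iUnion.2 ⟨Nat.pair k j, by simpa using ⟨hxs, hj⟩⟩
  · obtain ⟨y, hy, hAy⟩ := hA i.unpair.1 ⟨x, hx.1⟩ i.unpair.2
    simp only [hAy]
    have h1 : dist (fderiv ℝ γ x) (c i.unpair.1) < ε / 2 := hx.1.2
    have h2 : dist (fderiv ℝ γ y) (c i.unpair.1) < ε / 2 := hy.2
    refine (dist_eq_norm (fderiv ℝ γ x) (fderiv ℝ γ y)).symm.le.trans ?_
    linarith [dist_triangle_right (fderiv ℝ γ x) (fderiv ℝ γ y) (c i.unpair.1)]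

lemma measurableEmbedding_graphMap (he : ‖e‖ = 1) (hγ : Continuous γ) :
    MeasurableEmbedding (graphMap e γ) :=
  (continuous_graphMap hγ).measurableEmbedding (injective_graphMap he)

lemma ENNReal.le_of_forall_le_one_add_pow_mul {a b : ℝ≥0∞} (d : ℕ)
    (h : ∀ ε : ℝ≥0, ε ≠ 0 → a ≤ (1 + ε : ℝ≥0) ^ d * b) : a ≤ b := by
  have h1 : Tendsto (fun ε : ℝ≥0 => (((1 + ε : ℝ≥0) ^ d : ℝ≥0) : ℝ≥0∞) * b) (𝓝[>] 0)
      (𝓝 ((((1 + 0 : ℝ≥0) ^ d : ℝ≥0) : ℝ≥0∞) * b)) := by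
    refine ENNReal.Tendsto.mul_const ?_ (Or.inl (by simp))
    refine ENNReal.tendsto_coe.2 ?_
    exact (Continuous.tendsto (by fun_prop) 0).mono_left nhdsWithin_le_nhds
  have h2 : a ≤ _ := ge_of_tendsto h1 (by
    filter_upwards [self_mem_nhdsWithin] with ε hε
    simpa using h ε (ne_of_gt hε))
  simpa using h2

/-- The **area formula for Lipschitz graphs**: the image of a measurable set `A` under the graph
map has Hausdorff measure `∫ √(1 + |∇γ|²)` over `A`. -/
theorem euclideanHausdorffMeasure_image_graphMap (he : ‖e‖ = 1) {K : ℝ≥0} (hγ : LipschitzWith K γ)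
    {A : Set (hyperplane e)} (hA : MeasurableSet A) :
    Measure.euclideanHausdorffMeasure (Module.finrank ℝ (hyperplane e)) (graphMap e γ '' A) =
      ∫⁻ x in A, graphDensity γ x := by
  set d := Module.finrank ℝ (hyperplane e)
  have hemb := measurableEmbedding_graphMap he hγ.continuous
  let μ : Measure (hyperplane e) := (Measure.euclideanHausdorffMeasure d).comap (graphMap e γ)
  let ν : Measure (hyperplane e) := volume.withDensity (graphDensity γ)
  have hμ : ∀ B, μ B = Measure.euclideanHausdorffMeasure d (graphMap e γ '' B) :=
    fun B => hemb.comap_apply _ B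
  have hν : ∀ B, MeasurableSet B → ν B = ∫⁻ x in B, graphDensity γ x :=
    fun B hB => withDensity_apply _ hB
  have hN : volume {x | DifferentiableAt ℝ γ x}ᶜ = 0 := hγ.ae_differentiableAt (μ := volume)
  -- by Rademacher's theorem, and because the graph map is Lipschitz, points where `γ` is not
  -- differentiable do not matter
  have hμN : μ {x | DifferentiableAt ℝ γ x}ᶜ = 0 := by
    rw [hμ]
    have h := euclideanHausdorffMeasure_image_le_of_dist_le (f := (id : hyperplane e → hyperplane e))
      (g := graphMap e γ) (T := {x | DifferentiableAt ℝ γ x}ᶜ) (C := 1 + K)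
      (fun x _ y _ => by
        simpa using (lipschitzWith_graphMap he hγ).dist_le_mul x y) d
    rw [image_id, InnerProductSpace.euclideanHausdorffMeasure_eq_volume, hN, mul_zero] at h
    exact le_antisymm h zero_le
  have hνN : ν {x | DifferentiableAt ℝ γ x}ᶜ = 0 := withDensity_absolutelyContinuous _ _ hN
  rw [← hμ, ← hν A hA]
  -- on countably many pieces covering the rest, the measures agree up to a power of `1 + ε`
  apply le_antisymm
  · refine ENNReal.le_of_forall_le_one_add_pow_mul (d + 1) fun ε hε => ?_
    obtain ⟨S, a, hS, hcov, h⟩ := exists_cover_approximatesLinearOn γ hε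
    refine measure_le_mul_of_forall_subset hS (measure_mono_null (compl_subset_compl.2 hcov) hμN)
      (fun i T hTS hT => ?_) hA
    rw [hμ, hν T hT]
    exact (graph_area_piece he hT ((h i).1.mono_set hTS) fun x hx => (h i).2 x (hTS hx)).1
  · refine ENNReal.le_of_forall_le_one_add_pow_mul (d + 1) fun ε hε => ?_
    obtain ⟨S, a, hS, hcov, h⟩ := exists_cover_approximatesLinearOn γ hε
    refine measure_le_mul_of_forall_subset hS (measure_mono_null (compl_subset_compl.2 hcov) hνN)
      (fun i T hTS hT => ?_) hA
    rw [hμ, hν T hT]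
    exact (graph_area_piece he hT ((h i).1.mono_set hTS) fun x hx => (h i).2 x (hTS hx)).2

/-- The area formula for Lipschitz graphs, as an identity of measures. -/
theorem restrict_range_graphMap (he : ‖e‖ = 1) {K : ℝ≥0} (hγ : LipschitzWith K γ) :
    (Measure.euclideanHausdorffMeasure (Module.finrank ℝ (hyperplane e))).restrict
        (range (graphMap e γ)) =
      (volume.withDensity (graphDensity γ)).map (graphMap e γ) := by
  have hemb := measurableEmbedding_graphMap he hγ.continuous
  ext B hB
  rw [Measure.restrict_apply hB, hemb.map_apply, withDensity_apply _ (hemb.measurable hB),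
    ← image_preimage_eq_inter_range, euclideanHausdorffMeasure_image_graphMap he hγ
      (hemb.measurable hB)]

end GraphArea

/-! ### The divergence theorem above a Lipschitz graph -/

section Epigraph

variable {E : Type*} [NormedAddCommGroup E] [InnerProductSpace ℝ E] {e : E}

/-- The strict epigraph `⟪e, x⟫ > γ x'` of `γ`, with `x'` the projection of `x` to the hyperplane
orthogonal to `e`. -/
noncomputable def strictEpigraph (e : E) (γ : hyperplane e → ℝ) : Set E :=
  {x | γ ((hyperplane e).orthogonalProjectionOnto x) < inner ℝ e x}

lemma proj_coe_add_smul (x : hyperplane e) (t : ℝ) :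
    (hyperplane e).orthogonalProjectionOnto ((x : E) + t • e) = x := by
  have h : (hyperplane e).orthogonalProjectionOnto e = 0 :=
    Submodule.orthogonalProjectionOnto_orthogonal_apply_eq_zero (Submodule.mem_span_singleton_self e)
  rw [map_add, map_smul, h, smul_zero, add_zero, Submodule.orthogonalProjectionOnto_mem_subspace_eq_self]

lemma coe_proj_add_inner_smul (he : ‖e‖ = 1) (x : E) :
    ((hyperplane e).orthogonalProjectionOnto x : E) + (inner ℝ e x : ℝ) • e = x := by
  have h := Submodule.orthogonalProjectionOnto_orthogonal (K := Submodule.span ℝ {e}) x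
  rw [h, ← Submodule.starProjection_unit_singleton ℝ he]
  exact sub_add_cancel _ _

lemma mem_strictEpigraph_coe_add_smul (he : ‖e‖ = 1) {γ : hyperplane e → ℝ} (x : hyperplane e)
    (t : ℝ) : (x : E) + t • e ∈ strictEpigraph e γ ↔ γ x < t := by
  simp only [strictEpigraph, mem_ofPred_eq]
  rw [proj_coe_add_smul, inner_coe_add_smul he]

variable [FiniteDimensional ℝ E] [MeasurableSpace E] [BorelSpace E]

lemma measurePreserving_coe_add_smul (he : ‖e‖ = 1) :
    MeasurePreserving (fun p : hyperplane e × ℝ => (p.1 : E) + p.2 • e) volume volume := by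
  have h1 := ((Submodule.span ℝ {e}).measurePreserving_measurableEquivProd (0 : E)).symm
  rw [InnerProductSpace.euclideanHausdorffMeasure_eq_volume] at h1
  have h2 : MeasurePreserving (Prod.map (LinearIsometryEquiv.toSpanUnitSingleton (𝕜 := ℝ) e he)
      (id : hyperplane e → hyperplane e)) (volume.prod volume) (volume.prod volume) :=
    (LinearIsometryEquiv.measurePreserving _).prod (MeasurePreserving.id _)
  have h3 : MeasurePreserving (Prod.swap : hyperplane e × ℝ → ℝ × hyperplane e)
      (volume.prod volume) (volume.prod volume) := Measure.measurePreserving_swap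
  have h4 := h1.comp (h2.comp h3)
  convert! h4 using 1
  ext p
  simp [add_comm]

lemma measurableEmbedding_coe_add_smul (he : ‖e‖ = 1) :
    MeasurableEmbedding (fun p : hyperplane e × ℝ => (p.1 : E) + p.2 • e) := by
  refine Continuous.measurableEmbedding (by fun_prop) ?_
  rintro ⟨x, s⟩ ⟨y, t⟩ h
  have h : (x : E) + s • e = (y : E) + t • e := h
  have h1 := congrArg (inner ℝ e) h
  rw [inner_coe_add_smul he, inner_coe_add_smul he] at h1
  have h2 := congrArg (hyperplane e).orthogonalProjectionOnto h
  rw [proj_coe_add_smul, proj_coe_add_smul] at h2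
  rw [h1, h2]

omit [FiniteDimensional ℝ E] in
lemma measurableSet_strictEpigraph {b : hyperplane e → ℝ} (hb : Measurable b) :
    MeasurableSet (strictEpigraph e b) :=
  measurableSet_lt (hb.comp (ContinuousLinearMap.measurable _)) (by fun_prop)

/-- Fubini's theorem for an integral over an epigraph. -/
lemma integral_strictEpigraph (he : ‖e‖ = 1) {b : hyperplane e → ℝ} (hb : Measurable b)
    {G : E → ℝ} (hG : Integrable G) :
    Integrable (fun x : hyperplane e => ∫ t in Ioi (b x), G ((x : E) + t • e)) ∧
      ∫ x in strictEpigraph e b, G x =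
        ∫ x : hyperplane e, ∫ t in Ioi (b x), G ((x : E) + t • e) := by
  have hm := measurableSet_strictEpigraph hb
  have hmp := measurePreserving_coe_add_smul he
  have hemb := measurableEmbedding_coe_add_smul he
  have hi : ∀ p : hyperplane e × ℝ,
      (strictEpigraph e b).indicator G ((p.1 : E) + p.2 • e) =
        (Ioi (b p.1)).indicator (fun t => G ((p.1 : E) + t • e)) p.2 := by
    intro p
    by_cases hp : b p.1 < p.2
    · rw [indicator_of_mem ((mem_strictEpigraph_coe_add_smul he _ _).2 hp), indicator_of_mem (mem_Ioi.2 hp)]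
    · rw [indicator_of_notMem (fun h => hp ((mem_strictEpigraph_coe_add_smul he _ _).1 h)),
        indicator_of_notMem (mt mem_Ioi.1 hp)]
  have hint := (hmp.integrable_comp_emb hemb).2 (hG.indicator hm)
  have h1 : ∀ x : hyperplane e, ∫ t : ℝ, (strictEpigraph e b).indicator G ((x : E) + t • e) =
      ∫ t in Ioi (b x), G ((x : E) + t • e) := by
    intro x
    rw [← integral_indicator measurableSet_Ioi]
    exact integral_congr_ae (Eventually.of_forall fun t => hi (x, t))
  constructor
  · have := Integrable.integral_prod_left hint
    exact this.congr (Eventually.of_forall h1)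
  · rw [← integral_indicator hm, ← hmp.integral_comp hemb, Measure.volume_eq_prod]
    refine (integral_prod _ hint).trans ?_
    exact integral_congr_ae (Eventually.of_forall h1)

omit [FiniteDimensional ℝ E] [MeasurableSpace E] [BorelSpace E] in
lemma sub_smul_mem_strictEpigraph {γ : hyperplane e → ℝ} (x h : E) (τ : ℝ) :
    x - τ • h ∈ strictEpigraph e γ ↔ x ∈ strictEpigraph e fun y =>
      γ (y - τ • (hyperplane e).orthogonalProjectionOnto h) + τ * inner ℝ e h := by
  simp only [strictEpigraph, mem_ofPred_eq, map_sub, map_smul, inner_sub_right, inner_smul_right]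
  constructor <;> intro h <;> linarith

/-- Translating the function amounts to translating the epigraph, so the change of the integral is
an integral over the region between two graphs, evaluated by Fubini's theorem. -/
lemma integral_strictEpigraph_translate_sub (he : ‖e‖ = 1) {γ : hyperplane e → ℝ}
    (hγ : Continuous γ) {G : E → ℝ} (hGi : Integrable G) (h : E) (τ : ℝ) :
    Integrable (fun x : hyperplane e =>
      ∫ t in (γ (x - τ • (hyperplane e).orthogonalProjectionOnto h) + τ * inner ℝ e h)..(γ x),
        G ((x : E) + t • e)) ∧
    ∫ x in strictEpigraph e γ, (G (x + τ • h) - G x) =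
      ∫ x : hyperplane e,
        ∫ t in (γ (x - τ • (hyperplane e).orthogonalProjectionOnto h) + τ * inner ℝ e h)..(γ x),
          G ((x : E) + t • e) := by
  set b : hyperplane e → ℝ := fun y =>
      γ (y - τ • (hyperplane e).orthogonalProjectionOnto h) + τ * inner ℝ e h with hb
  have hbm : Measurable b := (by fun_prop : Continuous b).measurable
  obtain ⟨i1, e1⟩ := integral_strictEpigraph he hbm hGi
  obtain ⟨i2, e2⟩ := integral_strictEpigraph he hγ.measurable hGi
  have hslice : ∀ᵐ x : hyperplane e, Integrable (fun t : ℝ => G ((x : E) + t • e)) := by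
    have hint := ((measurePreserving_coe_add_smul he).integrable_comp_emb
      (measurableEmbedding_coe_add_smul he)).2 hGi
    exact Integrable.prod_right_ae hint
  have hsub : (fun x : hyperplane e => (∫ t in Ioi (b x), G ((x : E) + t • e)) -
      ∫ t in Ioi (γ x), G ((x : E) + t • e)) =ᵐ[volume]
      fun x => ∫ t in (b x)..(γ x), G ((x : E) + t • e) := by
    filter_upwards [hslice] with x hx
    rcases le_total (b x) (γ x) with hle | hle
    · exact intervalIntegral.integral_Ioi_sub_Ioi hx.integrableOn hle
    · rw [intervalIntegral.integral_symm, ← intervalIntegral.integral_Ioi_sub_Ioi hx.integrableOn hle]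
      ring
  refine ⟨(i1.sub i2).congr hsub, ?_⟩
  have hm := measurableSet_strictEpigraph hγ.measurable (e := e)
  have hm' := measurableSet_strictEpigraph hbm (e := e)
  rw [integral_sub (hGi.comp_add_right _).integrableOn hGi.integrableOn, e2]
  have e3 : ∫ x in strictEpigraph e γ, G (x + τ • h) = ∫ x in strictEpigraph e b, G x := by
    rw [← integral_indicator hm, ← integral_indicator hm',
      ← integral_sub_right_eq_self _ (τ • h)]
    refine integral_congr_ae (Eventually.of_forall fun x => ?_)
    by_cases hx : x - τ • h ∈ strictEpigraph e γ
    · simp only [indicator_of_mem hx, sub_add_cancel]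
      rw [indicator_of_mem ((sub_smul_mem_strictEpigraph x h τ).1 hx)]
    · simp only [indicator_of_notMem hx]
      rw [indicator_of_notMem fun h' => hx ((sub_smul_mem_strictEpigraph x h τ).2 h')]
  rw [e3, e1, ← integral_sub i1 i2]
  exact integral_congr_ae hsub

/-- At a point of differentiability of `γ`, the difference quotients of the shifted slices converge
to the flux density. -/
lemma tendsto_inv_mul_integral_slice {F : Type*} [NormedAddCommGroup F] [NormedSpace ℝ F]
    {γ : F → ℝ} {x k : F} (hx : DifferentiableAt ℝ γ x) {g : ℝ → ℝ} (hg : Continuous g) (s : ℝ) :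
    Tendsto (fun τ : ℝ => τ⁻¹ * ∫ t in (γ (x - τ • k) + τ * s)..(γ x), g t) (𝓝[>] 0)
      (𝓝 (g (γ x) * (fderiv ℝ γ x k - s))) := by
  have ha : HasDerivAt (fun τ : ℝ => γ (x - τ • k) + τ * s) (-(fderiv ℝ γ x k) + s) 0 := by
    have h1 : HasDerivAt (fun τ : ℝ => x - τ • k) (-k) 0 := by
      simpa using ((hasDerivAt_id (0 : ℝ)).smul_const k).const_sub x
    have hx' : HasFDerivAt γ (fderiv ℝ γ x) (x - (0 : ℝ) • k) := by simpa using hx.hasFDerivAt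
    have h2 := hx'.comp_hasDerivAt (0 : ℝ) h1
    exact (h2.add ((hasDerivAt_id (0 : ℝ)).mul_const s)).congr_deriv (by simp)
  have hQ : HasDerivAt (fun y => ∫ t in y..(γ x), g t) (-(g (γ x))) (γ x) :=
    intervalIntegral.integral_hasDerivAt_left (by simp)
      hg.stronglyMeasurable.stronglyMeasurableAtFilter hg.continuousAt
  have hQ' : HasDerivAt (fun y => ∫ t in y..(γ x), g t) (-(g (γ x)))
      ((fun τ : ℝ => γ (x - τ • k) + τ * s) 0) := by simpa using hQ
  have h := (hQ'.comp (0 : ℝ) ha).tendsto_slope_zero_right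
  simp only [Function.comp_def, zero_add, zero_smul, sub_zero, zero_mul, add_zero,
    intervalIntegral.integral_same, smul_eq_mul] at h
  convert! h using 2
  ring

/-- The **divergence theorem above a Lipschitz graph**: the integral of a directional derivative of
a compactly supported Lipschitz function over the epigraph is the limit of difference quotients,
that is, of the integrals over the thin region between the graph and its translates. -/
theorem integral_strictEpigraph_fderiv (he : ‖e‖ = 1) {γ : hyperplane e → ℝ} {K : ℝ≥0}
    (hγ : LipschitzWith K γ) {G : E → ℝ} {C : ℝ≥0} (hG : LipschitzWith C G)
    (hGc : HasCompactSupport G) (h : E) :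
    ∫ x in strictEpigraph e γ, fderiv ℝ G x h =
      ∫ x : hyperplane e, G (graphMap e γ x) *
        (fderiv ℝ γ x ((hyperplane e).orthogonalProjectionOnto h) - inner ℝ e h) := by
  have hGi : Integrable G := hG.continuous.integrable_of_hasCompactSupport hGc
  set k := (hyperplane e).orthogonalProjectionOnto h
  set s : ℝ := inner ℝ e h
  have hm := measurableSet_strictEpigraph hγ.continuous.measurable (e := e)
  obtain ⟨R, hR⟩ : ∃ R, tsupport G ⊆ Metric.closedBall 0 R := hGc.isBounded.subset_closedBall 0
  have hR0 : ∀ x, R < ‖x‖ → G x = 0 := fun x hx => by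
    refine image_eq_zero_of_notMem_tsupport fun hx' => ?_
    have := hR hx'
    rw [mem_closedBall_zero_iff] at this
    linarith
  -- the derivative as a limit of difference quotients, cut off to a ball containing all supports
  let B : Set E := strictEpigraph e γ ∩ Metric.closedBall 0 (R + ‖h‖)
  have hB : MeasurableSet B := hm.inter Metric.isClosed_closedBall.measurableSet
  have hgi : Integrable (B.indicator (fun _ => (1 : ℝ))) := by
    refine (integrable_indicator_iff hB).2 (integrableOn_const ?_)
    exact ((measure_mono inter_subset_right).trans_lt Metric.isBounded_closedBall.measure_lt_top).ne
  have T1 := hG.integral_inv_smul_sub_mul_tendsto_integral_lineDeriv_mul hgi h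
  have hcut : ∀ f : E → ℝ, (∀ x, R + ‖h‖ < ‖x‖ → f x = 0) →
      ∫ x, f x * B.indicator (fun _ => (1 : ℝ)) x = ∫ x in strictEpigraph e γ, f x := by
    intro f hf
    rw [← integral_indicator hm]
    refine integral_congr_ae (Eventually.of_forall fun x => ?_)
    by_cases hx : x ∈ strictEpigraph e γ
    · by_cases hx' : ‖x‖ ≤ R + ‖h‖
      · have : x ∈ B := ⟨hx, mem_closedBall_zero_iff.2 hx'⟩
        simp [this, hx]
      · simp [hf x (not_le.1 hx'), hx]
    · have : x ∉ B := fun h => hx h.1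
      simp [this, hx]
  have E1 : ∫ x, lineDeriv ℝ G x h * B.indicator (fun _ => (1 : ℝ)) x =
      ∫ x in strictEpigraph e γ, fderiv ℝ G x h := by
    have h1 : ∀ᵐ x, lineDeriv ℝ G x h = fderiv ℝ G x h := by
      filter_upwards [hG.ae_differentiableAt (μ := volume)] with x hx
      exact hx.lineDeriv_eq_fderiv
    rw [← hcut (fun x => fderiv ℝ G x h)]
    · refine integral_congr_ae ?_
      filter_upwards [h1] with x hx
      rw [hx]
    · intro x hx
      have hx' : x ∉ tsupport G := fun hx' => by
        have := mem_closedBall_zero_iff.1 (hR hx')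
        linarith [norm_nonneg h]
      have : fderiv ℝ G x = 0 := by
        by_contra h0
        exact hx' (support_fderiv_subset ℝ h0)
      rw [this]; rfl
  rw [E1] at T1
  -- the same difference quotients, computed by Fubini
  have E2 : ∀ᶠ τ : ℝ in 𝓝[>] 0,
      (∫ x, (τ⁻¹ • (G (x + τ • h) - G x)) * B.indicator (fun _ => (1 : ℝ)) x) =
      ∫ x : hyperplane e, τ⁻¹ * ∫ t in (γ (x - τ • k) + τ * s)..(γ x), G ((x : E) + t • e) := by
    filter_upwards [Ioc_mem_nhdsGT (zero_lt_one' ℝ)] with τ hτ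
    rw [hcut, integral_const_mul, ← (integral_strictEpigraph_translate_sub he hγ.continuous
      hGi h τ).2]
    · exact integral_const_mul _ _
    · intro x hx
      have h1 : ‖τ • h‖ ≤ ‖h‖ := by
        rw [norm_smul, Real.norm_of_nonneg hτ.1.le]
        nlinarith [norm_nonneg h, hτ.2]
      have h2 : ‖x‖ ≤ ‖x + τ • h‖ + ‖τ • h‖ := by
        simpa using norm_sub_le (x + τ • h) (τ • h)
      rw [hR0 x (by linarith [norm_nonneg h]), hR0 (x + τ • h) (by linarith)]
      simp
  obtain ⟨M, hM⟩ := hGc.exists_bound_of_continuous hG.continuous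
  have hM0 : 0 ≤ M := (norm_nonneg _).trans (hM 0)
  have T2 : Tendsto (fun τ : ℝ => ∫ x : hyperplane e,
      τ⁻¹ * ∫ t in (γ (x - τ • k) + τ * s)..(γ x), G ((x : E) + t • e)) (𝓝[>] 0)
      (𝓝 (∫ x : hyperplane e, G (graphMap e γ x) * (fderiv ℝ γ x k - s))) := by
    refine tendsto_integral_filter_of_dominated_convergence
      ((Metric.closedBall (0 : hyperplane e) R).indicator fun _ => M * (K * ‖k‖ + |s|)) ?_ ?_ ?_ ?_
    · exact Eventually.of_forall fun τ => ((integral_strictEpigraph_translate_sub he hγ.continuous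
        hGi h τ).1.const_mul _).aestronglyMeasurable
    · filter_upwards [self_mem_nhdsWithin] with τ hτ
      have hτ : 0 < τ := hτ
      refine Eventually.of_forall fun x => ?_
      by_cases hx : ‖x‖ ≤ R
      · rw [indicator_of_mem (mem_closedBall_zero_iff.2 hx), norm_mul, norm_inv,
          Real.norm_of_nonneg hτ.le, inv_mul_le_iff₀ hτ]
        have h1 := intervalIntegral.norm_integral_le_of_norm_le_const
          (a := γ (x - τ • k) + τ * s) (b := γ x) (f := fun t => G ((x : E) + t • e))
          (fun t _ => hM _)
        have h2 : |γ x - (γ (x - τ • k) + τ * s)| ≤ τ * (K * ‖k‖ + |s|) := by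
          have h3 := hγ.dist_le_mul x (x - τ • k)
          rw [Real.dist_eq, dist_eq_norm, sub_sub_cancel, norm_smul, Real.norm_of_nonneg hτ.le] at h3
          have h4 : |τ * s| = τ * |s| := by rw [abs_mul, abs_of_pos hτ]
          calc |γ x - (γ (x - τ • k) + τ * s)| = |(γ x - γ (x - τ • k)) - τ * s| := by ring_nf
            _ ≤ |γ x - γ (x - τ • k)| + |τ * s| := abs_sub _ _
            _ ≤ K * (τ * ‖k‖) + τ * |s| := by rw [h4]; gcongr
            _ = _ := by ring
        calc _ ≤ M * |γ x - (γ (x - τ • k) + τ * s)| := h1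
          _ ≤ M * (τ * (K * ‖k‖ + |s|)) := by gcongr
          _ = _ := by ring
      · have h0 : ∀ t : ℝ, G ((x : E) + t • e) = 0 := fun t =>
          hR0 _ ((not_le.1 hx).trans_le (norm_le_norm_coe_add_smul he x t))
        simp only [h0, intervalIntegral.integral_zero, mul_zero, norm_zero]
        exact indicator_nonneg (fun _ _ => by positivity) _
    · refine (integrable_indicator_iff Metric.isClosed_closedBall.measurableSet).2
        (integrableOn_const ?_)
      exact Metric.isBounded_closedBall.measure_lt_top.ne
    · filter_upwards [hγ.ae_differentiableAt (μ := volume)] with x hx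
      exact tendsto_inv_mul_integral_slice hx (g := fun t => G ((x : E) + t • e))
        (hG.continuous.comp (by fun_prop)) s
  exact tendsto_nhds_unique T1 (T2.congr' (E2.mono fun τ hτ => hτ.symm))

end Epigraph

/-! ### Normals and surface integrals in a boundary chart -/

section Normal

variable {n : ℕ}

theorem IsOutwardUnitNormal.unique {X : Set (EuclideanSpace ℝ (Fin n))}
    {x ν₁ ν₂ : EuclideanSpace ℝ (Fin n)} (h₁ : IsOutwardUnitNormal X x ν₁)
    (h₂ : IsOutwardUnitNormal X x ν₂) : ν₁ = ν₂ := by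
  by_contra hne
  -- the direction `ν₂ - ν₁` points into `X` according to `ν₁` and out of `X` according to `ν₂`
  set z := ν₂ - ν₁ with hz
  have hz0 : 0 < ‖z‖ := norm_pos_iff.2 (sub_ne_zero.2 (Ne.symm hne))
  have hzz : ‖z‖ ^ 2 = 2 - 2 * inner ℝ ν₂ ν₁ := by
    rw [hz, norm_sub_sq_real, h₁.1, h₂.1]; ring
  have hz2 : inner ℝ z ν₂ = ‖z‖ ^ 2 / 2 := by
    rw [hzz, hz, inner_sub_left, real_inner_self_eq_norm_sq, h₂.1, real_inner_comm]; ring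
  have hz1 : inner ℝ z ν₁ = -(‖z‖ ^ 2 / 2) := by
    rw [hzz, hz, inner_sub_left, real_inner_self_eq_norm_sq, h₁.1]; ring
  have hε : 0 < ‖z‖ / 4 := by positivity
  obtain ⟨r₁, hr₁, H₁⟩ := h₁.2 _ hε
  obtain ⟨r₂, hr₂, H₂⟩ := h₂.2 _ hε
  set s : ℝ := min r₁ r₂ / (2 * ‖z‖) with hs
  have hs0 : 0 < s := by positivity
  have hsz : ‖s • z‖ = min r₁ r₂ / 2 := by
    rw [norm_smul, Real.norm_of_nonneg hs0.le, hs]; field_simp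
  have hm : 0 < min r₁ r₂ := lt_min hr₁ hr₂
  have hsz' : ‖s • z‖ = s * ‖z‖ := by rw [norm_smul, Real.norm_of_nonneg hs0.le]
  have hb₁ : x + s • z ∈ Metric.ball x r₁ := by
    rw [mem_ball_iff_norm, add_sub_cancel_left, hsz]
    linarith [min_le_left r₁ r₂]
  have hb₂ : x + s • z ∈ Metric.ball x r₂ := by
    rw [mem_ball_iff_norm, add_sub_cancel_left, hsz]
    linarith [min_le_right r₁ r₂]
  have hpos : 0 < s * ‖z‖ ^ 2 := by positivity
  refine (H₂ _ hb₂).1 ?_ ((H₁ _ hb₁).2 ?_)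
  · rw [add_sub_cancel_left, hsz', inner_smul_left, hz2]
    simp only [conj_trivial]
    nlinarith
  · rw [add_sub_cancel_left, hsz', inner_smul_left, hz1]
    simp only [conj_trivial]
    nlinarith

lemma IsOutwardUnitNormal.outwardUnitNormal_eq {X : Set (EuclideanSpace ℝ (Fin n))}
    {x ν : EuclideanSpace ℝ (Fin n)} (h : IsOutwardUnitNormal X x ν) :
    outwardUnitNormal X x = ν :=
  (Classical.epsilon_spec (p := fun ν => IsOutwardUnitNormal X x ν) ⟨ν, h⟩).unique h

variable {X : Set (EuclideanSpace ℝ (Fin n))} {p e : EuclideanSpace ℝ (Fin n)} {r : ℝ}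
  {γ : hyperplane e → ℝ}

/-- The gradient of `γ`, as a vector of the hyperplane. -/
noncomputable def hyperplaneGradient (γ : hyperplane e → ℝ) (x : hyperplane e) : hyperplane e :=
  (InnerProductSpace.toDual ℝ (hyperplane e)).symm (fderiv ℝ γ x)

lemma inner_hyperplaneGradient (x k : hyperplane e) :
    inner ℝ (hyperplaneGradient γ x) k = fderiv ℝ γ x k := by
  simp [hyperplaneGradient]

lemma norm_hyperplaneGradient (x : hyperplane e) :
    ‖hyperplaneGradient γ x‖ = ‖fderiv ℝ γ x‖ := by
  simp [hyperplaneGradient]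

lemma inner_gradient_sub (x : hyperplane e) (h : EuclideanSpace ℝ (Fin n)) :
    inner ℝ h ((hyperplaneGradient γ x : EuclideanSpace ℝ (Fin n)) - e) =
      fderiv ℝ γ x ((hyperplane e).orthogonalProjectionOnto h) - inner ℝ e h := by
  rw [inner_sub_right, real_inner_comm e h, ← inner_hyperplaneGradient,
    real_inner_comm ((hyperplane e).orthogonalProjectionOnto h),
    Submodule.inner_orthogonalProjectionOnto_eq_of_mem_right]

/-- Where `γ` is differentiable, the normalization of `∇γ - e` is the outward normal to the
epigraph of `γ`; its norm before normalization is the area density. -/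
lemma isOutwardUnitNormal_graphMap (he : ‖e‖ = 1)
    (hX : ∀ x ∈ Metric.ball p r, (x ∈ X ↔ x ∈ strictEpigraph e γ)) {x : hyperplane e}
    (hx : graphMap e γ x ∈ Metric.ball p r) (hd : DifferentiableAt ℝ γ x) :
    IsOutwardUnitNormal X (graphMap e γ x)
      ((√(1 + ‖fderiv ℝ γ x‖ ^ 2))⁻¹ •
        ((hyperplaneGradient γ x : EuclideanSpace ℝ (Fin n)) - e)) := by
  set J := √(1 + ‖fderiv ℝ γ x‖ ^ 2) with hJ
  have hJ1 : 1 ≤ J := Real.one_le_sqrt.2 (by nlinarith [sq_nonneg ‖fderiv ℝ γ x‖])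
  have hJ0 : 0 < J := by linarith
  constructor
  · have h1 := norm_coe_add_smul_sq he (hyperplaneGradient γ x) (-1)
    rw [norm_hyperplaneGradient, neg_smul, one_smul, ← sub_eq_add_neg] at h1
    have h2 : ‖(hyperplaneGradient γ x : EuclideanSpace ℝ (Fin n)) - e‖ = J := by
      rw [hJ, eq_comm, Real.sqrt_eq_iff_mul_self_eq (by positivity) (norm_nonneg _)]
      nlinarith
    rw [norm_smul, h2, norm_inv, Real.norm_of_nonneg hJ0.le, inv_mul_cancel₀ hJ0.ne']
  · intro ε hε
    have hlo := (hasFDerivAt_iff_isLittleO_nhds_zero.1 hd.hasFDerivAt).def hε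
    obtain ⟨ρ, hρ, hlo⟩ := Metric.eventually_nhds_iff.1 hlo
    have hρ' : 0 < r - dist (graphMap e γ x) p := sub_pos.2 hx
    refine ⟨min ρ (r - dist (graphMap e γ x) p), lt_min hρ hρ', fun y hy => ?_⟩
    have hyp : y ∈ Metric.ball p r := by
      have h1 := (Metric.mem_ball.1 hy).trans_le (min_le_right _ _)
      have h2 := dist_triangle y (graphMap e γ x) p
      rw [Metric.mem_ball]; linarith
    set w := y - graphMap e γ x with hw
    set k := (hyperplane e).orthogonalProjectionOnto w with hk
    set s : ℝ := inner ℝ e w with hs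
    have hkw : ‖k‖ ≤ ‖w‖ := (hyperplane e).norm_orthogonalProjectionOnto_apply_le w
    have hpy : (hyperplane e).orthogonalProjectionOnto y = x + k := by
      rw [hk, hw, map_sub, graphMap, proj_coe_add_smul]; abel
    have hiy : inner ℝ e y = γ x + s := by
      rw [hs, hw, inner_sub_right, graphMap, inner_coe_add_smul he]; ring
    have hyX : y ∈ X ↔ γ (x + k) < γ x + s := by
      rw [hX y hyp]
      simp only [strictEpigraph, mem_ofPred_eq]
      rw [hpy, hiy]
    have hwρ : ‖w‖ < ρ := by
      rw [hw, ← dist_eq_norm]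
      exact (Metric.mem_ball.1 hy).trans_le (min_le_left _ _)
    have hlo' : |γ (x + k) - γ x - fderiv ℝ γ x k| ≤ ε * ‖k‖ :=
      hlo (by simpa using hkw.trans_lt hwρ)
    have hlo'' : |γ (x + k) - γ x - fderiv ℝ γ x k| ≤ ε * ‖w‖ := hlo'.trans (by gcongr)
    rw [inner_smul_right, inner_gradient_sub, ← hk, ← hs, hyX]
    have hεw : ε * ‖w‖ ≤ J * (ε * ‖w‖) := le_mul_of_one_le_left (by positivity) hJ1
    have hab := abs_le.1 hlo''
    constructor
    · intro h1
      rw [← div_eq_inv_mul, lt_div_iff₀ hJ0] at h1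
      linarith
    · intro h1
      rw [← div_eq_inv_mul, div_lt_iff₀ hJ0] at h1
      linarith

/-- The flux density of a constant vector field `h` through a Lipschitz graph. -/
lemma sqrt_mul_inner_outwardUnitNormal (he : ‖e‖ = 1)
    (hX : ∀ x ∈ Metric.ball p r, (x ∈ X ↔ x ∈ strictEpigraph e γ)) {x : hyperplane e}
    (hx : graphMap e γ x ∈ Metric.ball p r) (hd : DifferentiableAt ℝ γ x)
    (h : EuclideanSpace ℝ (Fin n)) :
    √(1 + ‖fderiv ℝ γ x‖ ^ 2) * inner ℝ h (outwardUnitNormal X (graphMap e γ x)) =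
      fderiv ℝ γ x ((hyperplane e).orthogonalProjectionOnto h) - inner ℝ e h := by
  rw [(isOutwardUnitNormal_graphMap he hX hx hd).outwardUnitNormal_eq, inner_smul_right,
    inner_gradient_sub, mul_inv_cancel_left₀]
  positivity

/-- In a boundary chart, the boundary of `X` is the graph. -/
lemma frontier_inter_ball (he : ‖e‖ = 1) (hXo : IsOpen X) (hγ : Continuous γ)
    (hX : ∀ x ∈ Metric.ball p r, (x ∈ X ↔ x ∈ strictEpigraph e γ)) :
    frontier X ∩ Metric.ball p r = range (graphMap e γ) ∩ Metric.ball p r := by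
  have hcont : Continuous fun y : EuclideanSpace ℝ (Fin n) =>
      γ ((hyperplane e).orthogonalProjectionOnto y) := by fun_prop
  have hcont' : Continuous fun y : EuclideanSpace ℝ (Fin n) => (inner ℝ e y : ℝ) := by fun_prop
  ext x
  refine and_congr_left fun hx => ?_
  rw [hXo.frontier_eq]
  constructor
  · rintro ⟨hcl, hn⟩
    have h1 : inner ℝ e x ≤ γ ((hyperplane e).orthogonalProjectionOnto x) :=
      not_lt.1 fun h => hn ((hX x hx).2 h)
    rcases h1.lt_or_eq with h1 | h1
    · exfalso
      have hev : ∀ᶠ y in 𝓝 x, inner ℝ e y < γ ((hyperplane e).orthogonalProjectionOnto y) :=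
        hcont'.continuousAt.eventually_lt hcont.continuousAt h1
      obtain ⟨y, ⟨hy1, hy2⟩, hyX⟩ := mem_closure_iff_nhds.1 hcl _
        (inter_mem hev (Metric.isOpen_ball.mem_nhds hx))
      have h2 : γ ((hyperplane e).orthogonalProjectionOnto y) < inner ℝ e y := (hX y hy2).1 hyX
      exact lt_asymm h2 hy1
    · refine ⟨(hyperplane e).orthogonalProjectionOnto x, ?_⟩
      rw [graphMap, ← h1, coe_proj_add_inner_smul he]
  · rintro ⟨y, rfl⟩
    refine ⟨?_, fun h => ?_⟩
    · have ht : Tendsto (fun t : ℝ => (y : EuclideanSpace ℝ (Fin n)) + (γ y + t) • e) (𝓝[>] 0)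
          (𝓝 (graphMap e γ y)) := by
        have hc : Continuous fun t : ℝ => (y : EuclideanSpace ℝ (Fin n)) + (γ y + t) • e := by
          fun_prop
        have := hc.tendsto 0
        simp only [add_zero] at this
        exact this.mono_left nhdsWithin_le_nhds
      refine mem_closure_of_tendsto ht ?_
      filter_upwards [ht (Metric.isOpen_ball.mem_nhds hx), self_mem_nhdsWithin] with t ht1 ht2
      refine (hX _ ht1).2 ((mem_strictEpigraph_coe_add_smul he _ _).2 ?_)
      linarith [mem_Ioi.1 ht2]
    · exact lt_irrefl _ ((mem_strictEpigraph_coe_add_smul he _ _).1 ((hX _ hx).1 h))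

lemma finrank_hyperplane (he : ‖e‖ = 1) : Module.finrank ℝ (hyperplane e) = n - 1 := by
  have he0 : e ≠ 0 := by
    rintro rfl
    simp at he
  rcases n with _ | k
  · exact absurd (Subsingleton.elim e 0) he0
  · have : Fact (Module.finrank ℝ (EuclideanSpace ℝ (Fin (k + 1))) = k + 1) := ⟨by simp⟩
    rw [Nat.add_sub_cancel]
    exact Submodule.finrank_orthogonal_span_singleton he0

lemma surfaceMeasure_restrict_ball (he : ‖e‖ = 1) (hXo : IsOpen X) (hγ : Continuous γ)
    (hX : ∀ x ∈ Metric.ball p r, (x ∈ X ↔ x ∈ strictEpigraph e γ)) :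
    (surfaceMeasure X).restrict (Metric.ball p r) =
      ((Measure.euclideanHausdorffMeasure (Module.finrank ℝ (hyperplane e))).restrict
        (range (graphMap e γ))).restrict (Metric.ball p r) := by
  rw [surfaceMeasure, Measure.restrict_restrict Metric.isOpen_ball.measurableSet,
    Measure.restrict_restrict Metric.isOpen_ball.measurableSet, inter_comm,
    frontier_inter_ball he hXo hγ hX, inter_comm, finrank_hyperplane he]

/-- The flux of a continuous multiple of a constant vector field, supported in a boundary chart, in
terms of the parametrization of the boundary as a graph. -/
theorem integral_surfaceMeasure_of_support_subset_ball (he : ‖e‖ = 1) (hXo : IsOpen X) {K : ℝ≥0}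
    (hγ : LipschitzWith K γ)
    (hX : ∀ x ∈ Metric.ball p r, (x ∈ X ↔ x ∈ strictEpigraph e γ))
    {g : EuclideanSpace ℝ (Fin n) → ℝ} (hg : Continuous g) (hgs : Function.support g ⊆ Metric.ball p r)
    (h : EuclideanSpace ℝ (Fin n)) :
    Integrable (fun x => g x * inner ℝ h (outwardUnitNormal X x)) (surfaceMeasure X) ∧
    ∫ x, g x * inner ℝ h (outwardUnitNormal X x) ∂surfaceMeasure X =
      ∫ x : hyperplane e, g (graphMap e γ x) *
        (fderiv ℝ γ x ((hyperplane e).orthogonalProjectionOnto h) - inner ℝ e h) := by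
  set q : EuclideanSpace ℝ (Fin n) → ℝ := fun x => g x * inner ℝ h (outwardUnitNormal X x) with hq
  have hemb := measurableEmbedding_graphMap he hγ.continuous
  have hg0 : ∀ x, x ∉ Metric.ball p r → g x = 0 := fun x hx => by
    by_contra h0
    exact hx (hgs h0)
  have hq0 : ∀ x, x ∉ Metric.ball p r → q x = 0 := fun x hx => by simp [hq, hg0 x hx]
  have hqs : Function.support q ⊆ Metric.ball p r := fun x hx => by
    by_contra h0
    exact hx (hq0 x h0)
  have hdens : (fun x : hyperplane e => (graphDensity γ x).toReal • q (graphMap e γ x)) =ᵐ[volume]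
      fun x => g (graphMap e γ x) *
        (fderiv ℝ γ x ((hyperplane e).orthogonalProjectionOnto h) - inner ℝ e h) := by
    filter_upwards [hγ.ae_differentiableAt (μ := volume)] with x hx
    by_cases hxb : graphMap e γ x ∈ Metric.ball p r
    · rw [← sqrt_mul_inner_outwardUnitNormal he hX hxb hx h, graphDensity,
        ENNReal.toReal_ofReal (Real.sqrt_nonneg _), smul_eq_mul, hq]
      ring
    · rw [hq0 _ hxb, hg0 _ hxb]; simp
  have hint : Integrable (fun x : hyperplane e => g (graphMap e γ x) *
      (fderiv ℝ γ x ((hyperplane e).orthogonalProjectionOnto h) - inner ℝ e h)) := by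
    have hc : Integrable (fun x : hyperplane e => g (graphMap e γ x)) := by
      refine (hg.comp (continuous_graphMap hγ.continuous)).integrable_of_hasCompactSupport ?_
      refine HasCompactSupport.intro (isCompact_closedBall (0 : hyperplane e) (‖p‖ + r)) ?_
      intro x hx
      refine hg0 _ fun hxb => hx ?_
      rw [mem_closedBall_zero_iff]
      have h1 := norm_le_norm_coe_add_smul he x (γ x)
      have h2 : ‖graphMap e γ x - p‖ < r := mem_ball_iff_norm.1 hxb
      have h3 : ‖graphMap e γ x‖ ≤ ‖graphMap e γ x - p‖ + ‖p‖ := by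
        simpa using norm_add_le (graphMap e γ x - p) p
      rw [graphMap] at h2 h3
      linarith
    refine hc.mul_bdd (c := K * ‖(hyperplane e).orthogonalProjectionOnto h‖ + ‖(inner ℝ e h : ℝ)‖)
      ?_ (Eventually.of_forall fun x => ?_)
    · exact ((measurable_fderiv_apply_const ℝ γ _).sub_const _).aestronglyMeasurable
    · refine (norm_sub_le _ _).trans ?_
      gcongr
      exact (ContinuousLinearMap.le_opNorm _ _).trans
        (by gcongr; exact norm_fderiv_le_of_lipschitz ℝ hγ)
  have hJm := measurable_graphDensity γ
  have hJt : ∀ᵐ x : hyperplane e, graphDensity γ x < ⊤ :=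
    Eventually.of_forall fun x => ENNReal.ofReal_lt_top
  have hb := surfaceMeasure_restrict_ball he hXo hγ.continuous hX
  rw [restrict_range_graphMap he hγ] at hb
  constructor
  · rw [← integrableOn_iff_integrable_of_support_subset hqs, IntegrableOn, hb, ← IntegrableOn,
      integrableOn_iff_integrable_of_support_subset hqs, hemb.integrable_map_iff,
      integrable_withDensity_iff_integrable_smul' hJm hJt]
    exact hint.congr hdens.symm
  · rw [← setIntegral_eq_integral_of_forall_compl_eq_zero hq0, hb,
      setIntegral_eq_integral_of_forall_compl_eq_zero hq0, hemb.integral_map,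
      integral_withDensity_eq_integral_toReal_smul hJm hJt]
    exact integral_congr_ae hdens

end Normal

/-! ### Functions that are Lipschitz along segments of a Lipschitz domain -/

section SegmentLipschitz

/-- `f` is Lipschitz with constant `L` along every segment contained in `X`. -/
def LipschitzAlongSegments {E F : Type*} [NormedAddCommGroup E] [NormedSpace ℝ E]
    [PseudoMetricSpace F] (L : ℝ≥0) (X : Set E) (f : E → F) : Prop :=
  ∀ x y, segment ℝ x y ⊆ X → dist (f x) (f y) ≤ L * dist x y

lemma LipschitzAlongSegments.lipschitzOnWith_of_convex {E F : Type*} [NormedAddCommGroup E]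
    [NormedSpace ℝ E] [PseudoMetricSpace F] {L : ℝ≥0} {X B : Set E} {f : E → F}
    (hf : LipschitzAlongSegments L X f) (hB : Convex ℝ B) (hBX : B ⊆ X) : LipschitzOnWith L f B :=
  LipschitzOnWith.of_dist_le_mul fun x hx y hy => hf x y ((hB.segment_subset hx hy).trans hBX)

lemma LipschitzAlongSegments.ae_differentiableAt {E F : Type*} [NormedAddCommGroup E]
    [NormedSpace ℝ E] [FiniteDimensional ℝ E] [MeasurableSpace E] [BorelSpace E] {μ : Measure E}
    [μ.IsAddHaarMeasure] [NormedAddCommGroup F] [NormedSpace ℝ F] [FiniteDimensional ℝ F]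
    {L : ℝ≥0} {X : Set E} {f : E → F} (hX : IsOpen X) (hf : LipschitzAlongSegments L X f) :
    ∀ᵐ x ∂μ.restrict X, DifferentiableAt ℝ f x := by
  rw [ae_restrict_iff' hX.measurableSet, ae_iff]
  refine measure_null_of_locally_null _ fun x hx => ?_
  have hxX : x ∈ X := by by_contra h; exact hx fun h' => absurd h' h
  obtain ⟨r, hr, hrX⟩ := Metric.isOpen_iff.1 hX x hxX
  have hL := hf.lipschitzOnWith_of_convex (convex_ball x r) hrX
  have hd := hL.ae_differentiableWithinAt_of_mem (μ := μ)
  refine ⟨{a | ¬(a ∈ X → DifferentiableAt ℝ f a)} ∩ Metric.ball x r,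
    inter_mem self_mem_nhdsWithin (mem_nhdsWithin_of_mem_nhds (Metric.ball_mem_nhds x hr)), ?_⟩
  refine measure_mono_null (fun y hy => ?_) (ae_iff.1 hd)
  rintro h
  exact hy.1 fun _ => (h hy.2).differentiableAt (Metric.isOpen_ball.mem_nhds hy.2)

/-- In a boundary chart any two points are joined by a path of comparable length: up, across, and
down. -/
lemma LipschitzAlongSegments.lipschitzOnWith_chart {E F : Type*} [NormedAddCommGroup E]
    [InnerProductSpace ℝ E] [PseudoMetricSpace F] {X : Set E} {p e : E} {r : ℝ}
    {γ : hyperplane e → ℝ} {K : ℝ≥0} (he : ‖e‖ = 1) (hγ : LipschitzWith K γ)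
    (hX : ∀ x ∈ Metric.ball p r, (x ∈ X ↔ x ∈ strictEpigraph e γ)) {L : ℝ≥0} {f : E → F}
    (hf : LipschitzAlongSegments L X f) :
    LipschitzOnWith (L * (1 + 2 * K)) f (X ∩ Metric.ball p (r / (1 + 2 * K))) := by
  refine LipschitzOnWith.of_dist_le_mul fun x hx y hy => ?_
  set ρ := r / (1 + 2 * K) with hρ
  have hK : (0 : ℝ) ≤ K := K.2
  have hr : r = ρ * (1 + 2 * K) := by rw [hρ]; field_simp
  set d := dist x y with hd
  have hxp : ‖x - p‖ < ρ := mem_ball_iff_norm.1 hx.2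
  have hyp : ‖y - p‖ < ρ := mem_ball_iff_norm.1 hy.2
  have hd0 : 0 ≤ d := dist_nonneg
  have hd2 : d < 2 * ρ := by
    have := dist_triangle_right x y p
    rw [dist_eq_norm x p, dist_eq_norm y p] at this
    linarith
  have hρ0 : 0 < ρ := (norm_nonneg _).trans_lt hxp
  -- lifting by `K * d` clears the graph along the way from `x` to `y`; the radius `ρ` leaves room
  -- for this inside the chart
  have hsub : ∀ z t, ‖z - p‖ < ρ → 0 ≤ t → t ≤ K * d → z + t • e ∈ Metric.ball p r := by
    intro z t hz ht0 ht
    rw [mem_ball_iff_norm, hr]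
    have h1 : ‖z + t • e - p‖ ≤ ‖z - p‖ + ‖t • e‖ := by
      rw [add_sub_right_comm]; exact norm_add_le _ _
    rw [norm_smul, he, mul_one, Real.norm_of_nonneg ht0] at h1
    nlinarith [mul_le_mul_of_nonneg_left hd2.le hK]
  have hball : ∀ z, ‖z - p‖ < ρ → z ∈ Metric.ball p r := fun z hz => by
    simpa using hsub z 0 hz le_rfl (by positivity)
  have hxe : γ ((hyperplane e).orthogonalProjectionOnto x) < inner ℝ e x :=
    (hX x (hball x hxp)).1 hx.1
  have hye : γ ((hyperplane e).orthogonalProjectionOnto y) < inner ℝ e y :=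
    (hX y (hball y hyp)).1 hy.1
  have hPe : (hyperplane e).orthogonalProjectionOnto e = 0 :=
    Submodule.orthogonalProjectionOnto_orthogonal_apply_eq_zero
      (Submodule.mem_span_singleton_self e)
  have hup : ∀ z t, ‖z - p‖ < ρ → 0 ≤ t → t ≤ K * d →
      γ ((hyperplane e).orthogonalProjectionOnto z) < inner ℝ e z + t → z + t • e ∈ X := by
    intro z t hz ht0 ht hzt
    refine (hX _ (hsub z t hz ht0 ht)).2 ?_
    simp only [strictEpigraph, mem_ofPred_eq]
    rw [map_add, map_smul, hPe, smul_zero, add_zero, inner_add_right, inner_smul_right,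
      real_inner_self_eq_norm_sq, he]
    linarith
  have hvert : ∀ z, ‖z - p‖ < ρ → γ ((hyperplane e).orthogonalProjectionOnto z) < inner ℝ e z →
      segment ℝ z (z + (K * d) • e) ⊆ X := by
    rintro z hz hze w hw
    rw [segment_eq_image'] at hw
    obtain ⟨s, hs, rfl⟩ := hw
    simp only [add_sub_cancel_left, smul_smul]
    have h0 : 0 ≤ s * (K * d) := mul_nonneg hs.1 (by positivity)
    exact hup z _ hz h0 (mul_le_of_le_one_left (by positivity) hs.2) (by linarith)
  have hacross : segment ℝ (x + (K * d) • e) (y + (K * d) • e) ⊆ X := by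
    rintro w ⟨a, b, ha, hb, hab, rfl⟩
    have hw : a • (x + (K * d) • e) + b • (y + (K * d) • e) = (a • x + b • y) + (K * d) • e := by
      rw [smul_add, smul_add, add_add_add_comm, ← add_smul, hab, one_smul]
    rw [hw]
    have hz : ‖a • x + b • y - p‖ < ρ :=
      mem_ball_iff_norm.1 (convex_ball p ρ hx.2 hy.2 ha hb hab)
    refine hup _ _ hz (by positivity) le_rfl ?_
    set z := a • x + b • y
    set P := (hyperplane e).orthogonalProjectionOnto
    have hPle : ∀ w w' : E, γ (P w) ≤ γ (P w') + K * ‖w - w'‖ := by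
      intro w w'
      have h1 := hγ.dist_le_mul (P w) (P w')
      have h2 : dist (P w) (P w') ≤ ‖w - w'‖ := by
        rw [dist_eq_norm, ← map_sub]
        exact (hyperplane e).norm_orthogonalProjectionOnto_apply_le _
      have h3 := (abs_le.1 (Real.dist_eq (γ (P w)) _ ▸ h1)).2
      nlinarith
    have hzx : ‖z - x‖ ≤ d := by
      have : z - x = b • (y - x) := by
        simp only [z]
        rw [← eq_sub_iff_add_eq] at hab
        rw [hab, sub_smul, smul_sub, one_smul]; abel
      rw [this, norm_smul, Real.norm_of_nonneg hb, ← dist_eq_norm, dist_comm]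
      exact mul_le_of_le_one_left hd0 (by linarith)
    have hzy : ‖z - y‖ ≤ d := by
      have : z - y = a • (x - y) := by
        simp only [z]
        rw [← eq_sub_iff_add_eq'] at hab
        rw [hab, sub_smul, smul_sub, one_smul]; abel
      rw [this, norm_smul, Real.norm_of_nonneg ha, ← dist_eq_norm]
      exact mul_le_of_le_one_left hd0 (by linarith)
    have hx1 : γ (P z) < inner ℝ e x + K * d := by
      nlinarith [hPle z x, mul_le_mul_of_nonneg_left hzx hK]
    have hy1 : γ (P z) < inner ℝ e y + K * d := by
      nlinarith [hPle z y, mul_le_mul_of_nonneg_left hzy hK]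
    have hin : inner ℝ e z = a * inner ℝ e x + b * inner ℝ e y := by
      simp only [z]
      rw [inner_add_right, inner_smul_right, inner_smul_right]
    rw [hin]
    have hb' : b = 1 - a := by linarith
    rcases ha.eq_or_lt with h0 | h0
    · rw [hb', ← h0]; linarith
    · have m1 := mul_lt_mul_of_pos_left hx1 h0
      have m2 := mul_le_mul_of_nonneg_left hy1.le hb
      rw [hb'] at m2 ⊢
      linarith
  have h1 := hf _ _ (hvert x hxp hxe)
  have h2 := hf _ _ hacross
  have h3 := hf _ _ (hvert y hyp hye)
  have hv : ∀ z : E, dist z (z + (K * d) • e) = K * d := fun z => by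
    rw [dist_self_add_right, norm_smul, he, mul_one, Real.norm_of_nonneg (by positivity)]
  rw [hv] at h1 h3
  rw [dist_add_right] at h2
  have h4 := dist_triangle4 (f x) (f (x + (K * d) • e)) (f (y + (K * d) • e)) (f y)
  rw [dist_comm (f (y + (K * d) • e))] at h4
  push_cast
  calc dist (f x) (f y) ≤ L * (K * d) + L * d + L * (K * d) := by linarith
    _ = L * (1 + 2 * K) * d := by ring

/-- Lipschitz continuity along segments improves to local Lipschitz continuity up to the boundary
of a Lipschitz domain. -/
lemma exists_ball_lipschitzOnWith {n : ℕ} {F : Type*} [PseudoMetricSpace F]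
    {X : Set (EuclideanSpace ℝ (Fin n))} (hXo : IsOpen X) (hXL : HasLipschitzBoundary X)
    {L : ℝ≥0} {f : EuclideanSpace ℝ (Fin n) → F} (hf : LipschitzAlongSegments L X f)
    {p : EuclideanSpace ℝ (Fin n)} (hp : p ∈ closure X) :
    ∃ r > 0, ∃ C, LipschitzOnWith C f (X ∩ Metric.ball p r) := by
  by_cases hpX : p ∈ X
  · obtain ⟨r, hr, hrX⟩ := Metric.isOpen_iff.1 hXo p hpX
    exact ⟨r, hr, L, (hf.lipschitzOnWith_of_convex (convex_ball p r) hrX).mono inter_subset_right⟩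
  · obtain ⟨e, he, γ, K, hγ, r, hr, hX⟩ := hXL p (hXo.frontier_eq ▸ ⟨hp, hpX⟩)
    exact ⟨r / (1 + 2 * K), by positivity, _, hf.lipschitzOnWith_chart he hγ hX⟩

end SegmentLipschitz

/-! ### The divergence theorem on a Lipschitz domain -/

section GaussGreen

lemma exists_lipschitzWith_mul {E : Type*} [PseudoMetricSpace E] {ψ g : E → ℝ} {C D : ℝ≥0}
    (hψ : LipschitzWith C ψ) (hψc : HasCompactSupport ψ) (hg : LipschitzWith D g) :
    ∃ M, LipschitzWith M fun x => ψ x * g x := by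
  obtain ⟨A, hA⟩ := hψc.exists_bound_of_continuous hψ.continuous
  obtain ⟨B, hB⟩ := hψc.isCompact.exists_bound_of_continuousOn hg.continuous.continuousOn
  set A' := A.toNNReal
  set B' := B.toNNReal
  have hA' : ∀ x, |ψ x| ≤ A' := fun x => (hA x).trans (Real.le_coe_toNNReal A)
  have hB' : ∀ x ∈ tsupport ψ, |g x| ≤ B' := fun x hx => (hB x hx).trans (Real.le_coe_toNNReal B)
  have key : ∀ x y, x ∈ tsupport ψ → |ψ x * g x - ψ y * g y| ≤ (B' * C + A' * D) * dist x y := by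
    intro x y hx
    have h1 : |ψ x - ψ y| ≤ C * dist x y := hψ.dist_le_mul x y
    have h2 : |g x - g y| ≤ D * dist x y := hg.dist_le_mul x y
    calc |ψ x * g x - ψ y * g y| = |g x * (ψ x - ψ y) + ψ y * (g x - g y)| := by ring_nf
      _ ≤ |g x| * |ψ x - ψ y| + |ψ y| * |g x - g y| := by
          rw [← abs_mul, ← abs_mul]; exact abs_add_le _ _
      _ ≤ B' * (C * dist x y) + A' * (D * dist x y) := by
          gcongr
          exacts [hB' x hx, hA' y]
      _ = _ := by ring
  refine ⟨B' * C + A' * D, LipschitzWith.of_dist_le_mul fun x y => ?_⟩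
  rw [Real.dist_eq]
  push_cast
  by_cases hx : x ∈ tsupport ψ
  · exact key x y hx
  by_cases hy : y ∈ tsupport ψ
  · rw [abs_sub_comm, dist_comm]
    exact key y x hy
  · rw [image_eq_zero_of_notMem_tsupport hx, image_eq_zero_of_notMem_tsupport hy]
    simp only [zero_mul, sub_self, abs_zero]
    positivity

lemma LipschitzWith.integral_fderiv_eq_zero {E : Type*} [NormedAddCommGroup E] [NormedSpace ℝ E]
    [FiniteDimensional ℝ E] [MeasurableSpace E] [BorelSpace E] {μ : Measure E}
    [μ.IsAddHaarMeasure] {G : E → ℝ} {C : ℝ≥0} (hG : LipschitzWith C G)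
    (hGc : HasCompactSupport G) (h : E) : ∫ x, fderiv ℝ G x h ∂μ = 0 := by
  have h1 := LipschitzWith.integral_lineDeriv_mul_eq (μ := μ)
    (LipschitzWith.const' (1 : ℝ) : LipschitzWith 0 fun _ : E => (1 : ℝ)) hG hGc (-h)
  have h2 : ∫ x, fderiv ℝ G x h ∂μ = ∫ x, lineDeriv ℝ G x (- -h) * 1 ∂μ := by
    refine integral_congr_ae ?_
    filter_upwards [hG.ae_differentiableAt (μ := μ)] with x hx
    rw [hx.lineDeriv_eq_fderiv, neg_neg, mul_one]
  rw [h2, ← h1]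
  simp [lineDeriv]

variable {n : ℕ} {X : Set (EuclideanSpace ℝ (Fin n))}

/-- The divergence theorem for a function `ψ f` supported near a point of the closure. -/
lemma exists_ball_integral_fderiv_mul (hXo : IsOpen X) (hXb : Bornology.IsBounded X)
    (hXL : HasLipschitzBoundary X) {f : EuclideanSpace ℝ (Fin n) → ℝ} {L : ℝ≥0}
    (hfc : ContinuousOn f (closure X)) (hf : LipschitzAlongSegments L X f)
    {p : EuclideanSpace ℝ (Fin n)} (hp : p ∈ closure X) :
    ∃ r > 0, ∀ ψ : EuclideanSpace ℝ (Fin n) → ℝ, ContDiff ℝ ∞ ψ → tsupport ψ ⊆ Metric.ball p r →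
      ∀ h : EuclideanSpace ℝ (Fin n),
        IntegrableOn (fun x => fderiv ℝ (fun y => ψ y * f y) x h) X ∧
        Integrable (fun x => ψ x * f x * inner ℝ h (outwardUnitNormal X x)) (surfaceMeasure X) ∧
        ∫ x in X, fderiv ℝ (fun y => ψ y * f y) x h =
          ∫ x, ψ x * f x * inner ℝ h (outwardUnitNormal X x) ∂surfaceMeasure X := by
  obtain ⟨r₀, hr₀, C, hC⟩ := exists_ball_lipschitzOnWith hXo hXL hf hp
  obtain ⟨f₁, hf₁, hff₁⟩ := hC.extend_real
  have hfc₁ : EqOn f f₁ (closure X ∩ Metric.ball p r₀) := by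
    refine (hff₁.of_subset_closure (hfc.mono inter_subset_left) hf₁.continuous.continuousOn
      (inter_subset_inter_left _ subset_closure) ?_)
    rintro x ⟨hx, hxb⟩
    rw [inter_comm]
    exact Metric.isOpen_ball.inter_closure ⟨hxb, hx⟩
  -- everything but the evaluation of the two integrals
  have main : ∀ r ≤ r₀, ∀ ψ : EuclideanSpace ℝ (Fin n) → ℝ, ContDiff ℝ ∞ ψ →
      tsupport ψ ⊆ Metric.ball p r → ∃ G : EuclideanSpace ℝ (Fin n) → ℝ, (∃ D, LipschitzWith D G) ∧
        HasCompactSupport G ∧ Function.support G ⊆ Metric.ball p r ∧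
        (∀ x, x ∉ Metric.ball p r → fderiv ℝ G x = 0) ∧
        (∀ x ∈ closure X, ψ x * f x = G x) ∧
        (∀ x ∈ X, fderiv ℝ (fun y => ψ y * f y) x = fderiv ℝ G x) := by
    intro r hr ψ hψ hψs
    have hψc : HasCompactSupport ψ := HasCompactSupport.of_support_subset_isCompact
      (isCompact_closedBall p r) ((subset_tsupport ψ).trans (hψs.trans Metric.ball_subset_closedBall))
    obtain ⟨D, hD⟩ := hψ.lipschitzWith_of_hasCompactSupport hψc (by simp)
    have hts : tsupport (fun x => ψ x * f₁ x) ⊆ tsupport ψ := tsupport_mul_subset_left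
    have heq : ∀ x ∈ closure X, ψ x * f x = ψ x * f₁ x := by
      intro x hx
      by_cases hxb : x ∈ Metric.ball p r
      · rw [hfc₁ ⟨hx, Metric.ball_subset_ball hr hxb⟩]
      · rw [image_eq_zero_of_notMem_tsupport fun h => hxb (hψs h), zero_mul, zero_mul]
    refine ⟨fun x => ψ x * f₁ x, exists_lipschitzWith_mul hD hψc hf₁, hψc.mul_right,
      (subset_tsupport _).trans (hts.trans hψs), ?_, heq, ?_⟩
    · intro x hx
      by_contra h0
      exact hx (hψs (hts (support_fderiv_subset ℝ h0)))
    · intro x hx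
      refine Filter.EventuallyEq.fderiv_eq ?_
      filter_upwards [hXo.mem_nhds hx] with y hy
      exact heq y (subset_closure hy)
  have hXvol : volume X ≠ ⊤ := hXb.measure_lt_top.ne
  have hint : ∀ (G : EuclideanSpace ℝ (Fin n) → ℝ) (D : ℝ≥0), LipschitzWith D G → ∀ h,
      IntegrableOn (fun x => fderiv ℝ G x h) X := by
    intro G D hG h
    refine Measure.integrableOn_of_bounded (M := D * ‖h‖) hXvol
      (measurable_fderiv_apply_const ℝ G h).aestronglyMeasurable (Eventually.of_forall fun x => ?_)
    exact (ContinuousLinearMap.le_opNorm _ _).trans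
      (by gcongr; exact norm_fderiv_le_of_lipschitz ℝ hG)
  have hσ : ∀ᵐ x ∂surfaceMeasure X, x ∈ frontier X :=
    ae_restrict_mem isClosed_frontier.measurableSet
  by_cases hpX : p ∈ X
  · obtain ⟨r₁, hr₁, hrX⟩ := Metric.isOpen_iff.1 hXo p hpX
    refine ⟨min r₀ r₁, lt_min hr₀ hr₁, fun ψ hψ hψs h => ?_⟩
    obtain ⟨G, ⟨D, hD⟩, hGc, hGs, hG0, hGf, hGd⟩ := main _ (min_le_left _ _) ψ hψ hψs
    have hbX : Metric.ball p (min r₀ r₁) ⊆ X :=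
      (Metric.ball_subset_ball (min_le_right _ _)).trans hrX
    have hz : (fun x => ψ x * f x * inner ℝ h (outwardUnitNormal X x)) =ᵐ[surfaceMeasure X]
        fun _ => 0 := by
      filter_upwards [hσ] with x hx
      have hxX : x ∉ X := (hXo.frontier_eq ▸ hx).2
      rw [image_eq_zero_of_notMem_tsupport fun h => hxX (hbX (hψs h)), zero_mul, zero_mul]
    refine ⟨(hint G D hD h).congr_fun (fun x hx => by simp only [hGd x hx]) hXo.measurableSet,
      (integrable_zero _ _ _).congr hz.symm, ?_⟩
    rw [integral_congr_ae hz, integral_zero, setIntegral_congr_fun hXo.measurableSet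
      (fun x hx => by simp only [hGd x hx] : EqOn _ (fun x => fderiv ℝ G x h) X),
      setIntegral_eq_integral_of_forall_compl_eq_zero, hD.integral_fderiv_eq_zero hGc]
    intro x hx
    rw [hG0 x fun h => hx (hbX h)]; rfl
  · have hpf : p ∈ frontier X := hXo.frontier_eq ▸ ⟨hp, hpX⟩
    obtain ⟨e, he, γ, K, hγ, r₁, hr₁, hXγ⟩ := hXL p hpf
    refine ⟨min r₀ r₁, lt_min hr₀ hr₁, fun ψ hψ hψs h => ?_⟩
    have hX : ∀ x ∈ Metric.ball p (min r₀ r₁), (x ∈ X ↔ x ∈ strictEpigraph e γ) := fun x hx =>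
      hXγ x (Metric.ball_subset_ball (min_le_right _ _) hx)
    obtain ⟨G, ⟨D, hD⟩, hGc, hGs, hG0, hGf, hGd⟩ := main _ (min_le_left _ _) ψ hψ hψs
    obtain ⟨hi, hs⟩ := integral_surfaceMeasure_of_support_subset_ball he hXo hγ hX hD.continuous
      hGs h
    have hz : (fun x => ψ x * f x * inner ℝ h (outwardUnitNormal X x)) =ᵐ[surfaceMeasure X]
        fun x => G x * inner ℝ h (outwardUnitNormal X x) := by
      filter_upwards [hσ] with x hx
      rw [hGf x (frontier_subset_closure hx)]
    refine ⟨(hint G D hD h).congr_fun (fun x hx => by simp only [hGd x hx]) hXo.measurableSet,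
      hi.congr hz.symm, ?_⟩
    rw [integral_congr_ae hz, hs, ← integral_strictEpigraph_fderiv he hγ hD hGc,
      setIntegral_congr_fun hXo.measurableSet
      (fun x hx => by simp only [hGd x hx] : EqOn _ (fun x => fderiv ℝ G x h) X),
      ← integral_indicator hXo.measurableSet,
      ← integral_indicator (measurableSet_strictEpigraph hγ.continuous.measurable)]
    congr 1
    ext x
    by_cases hx : x ∈ Metric.ball p (min r₀ r₁)
    · by_cases hxX : x ∈ X
      · rw [indicator_of_mem hxX, indicator_of_mem ((hX x hx).1 hxX)]
      · rw [indicator_of_notMem hxX, indicator_of_notMem fun h => hxX ((hX x hx).2 h)]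
    · have h0 : fderiv ℝ G x h = 0 := by rw [hG0 x hx]; rfl
      simp [indicator, h0]

/-- The **divergence theorem** on a bounded Lipschitz domain, for a directional derivative of a
function which is continuous up to the boundary and Lipschitz along segments. -/
theorem integral_fderiv_eq_integral_surfaceMeasure (hXo : IsOpen X) (hXb : Bornology.IsBounded X)
    (hXL : HasLipschitzBoundary X) {f : EuclideanSpace ℝ (Fin n) → ℝ} {L : ℝ≥0}
    (hfc : ContinuousOn f (closure X)) (hf : LipschitzAlongSegments L X f)
    (h : EuclideanSpace ℝ (Fin n)) :
    IntegrableOn (fun x => fderiv ℝ f x h) X ∧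
      Integrable (fun x => f x * inner ℝ h (outwardUnitNormal X x)) (surfaceMeasure X) ∧
      ∫ x in X, fderiv ℝ f x h =
        ∫ x, f x * inner ℝ h (outwardUnitNormal X x) ∂surfaceMeasure X := by
  choose! r hr hloc using fun p (hp : p ∈ closure X) =>
    exists_ball_integral_fderiv_mul hXo hXb hXL hfc hf hp
  have hcomp : IsCompact (closure X) := hXb.isCompact_closure
  obtain ⟨t, ht, htc⟩ := hcomp.elim_nhds_subcover (fun p => Metric.ball p (r p))
    fun p hp => Metric.ball_mem_nhds p (hr p hp)
  obtain ⟨ρ, hρ⟩ := SmoothPartitionOfUnity.exists_isSubordinate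
    (modelWithCornersSelf ℝ (EuclideanSpace ℝ (Fin n))) isClosed_closure
    (fun p : t => Metric.ball (p : EuclideanSpace ℝ (Fin n)) (r p)) (fun _ => Metric.isOpen_ball)
    (s := closure X) (by
      intro x hx
      obtain ⟨p, hp, hxp⟩ := mem_iUnion₂.1 (htc hx)
      exact mem_iUnion.2 ⟨⟨p, hp⟩, hxp⟩)
  have hρs : ∀ i : t, ContDiff ℝ ∞ (ρ i) := fun i => (ρ i).contMDiff.contDiff
  have hρ1 : ∀ x ∈ closure X, ∑ i, ρ i x = 1 := fun x hx => by
    rw [← finsum_eq_sum_of_fintype]; exact ρ.sum_eq_one hx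
  have hL := fun i : t => hloc i (ht i i.2) (ρ i) (hρs i) (hρ i) h
  have hfsum : ∀ x ∈ closure X, f x = ∑ i, ρ i x * f x := fun x hx => by
    rw [← Finset.sum_mul, hρ1 x hx, one_mul]
  have hd : ∀ᵐ x ∂volume.restrict X,
      ∑ i, fderiv ℝ (fun y => ρ i y * f y) x h = fderiv ℝ f x h := by
    filter_upwards [hf.ae_differentiableAt (μ := volume) hXo, ae_restrict_mem hXo.measurableSet]
      with x hx hxX
    have h1 : f =ᶠ[𝓝 x] fun y => ∑ i, ρ i y * f y := by
      filter_upwards [hXo.mem_nhds hxX] with y hy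
      exact hfsum y (subset_closure hy)
    have h2 : ∀ i ∈ (Finset.univ : Finset t), DifferentiableAt ℝ (fun y => ρ i y * f y) x :=
      fun i _ => ((hρs i).differentiable (by simp) x).mul hx
    rw [h1.fderiv_eq, fderiv_fun_sum h2]
    simp
  have hσ : (fun x => ∑ i, ρ i x * f x * inner ℝ h (outwardUnitNormal X x)) =ᵐ[surfaceMeasure X]
      fun x => f x * inner ℝ h (outwardUnitNormal X x) := by
    have : ∀ᵐ x ∂surfaceMeasure X, x ∈ frontier X :=
      ae_restrict_mem isClosed_frontier.measurableSet
    filter_upwards [this] with x hx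
    rw [← Finset.sum_mul, ← hfsum x (frontier_subset_closure hx)]
  refine ⟨(integrable_finsetSum _ fun i _ => (hL i).1).congr hd,
    (integrable_finsetSum _ fun i _ => (hL i).2.1).congr hσ, ?_⟩
  rw [← integral_congr_ae hd, ← integral_congr_ae hσ, integral_finsetSum _ fun i _ => (hL i).1,
    integral_finsetSum _ fun i _ => (hL i).2.1]
  exact Finset.sum_congr rfl fun i _ => (hL i).2.2

end GaussGreen

/-! ### Lipschitz representatives of bounded Sobolev functions -/

section Sobolev

variable {n m : ℕ} {X : Set (EuclideanSpace ℝ (Fin n))}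

/-- `d` is the weak derivative of the scalar function `g` on `X` in the direction of the `j`-th
coordinate, in the sense of integration by parts. -/
def IsWeakPartial (X : Set (EuclideanSpace ℝ (Fin n))) (g d : EuclideanSpace ℝ (Fin n) → ℝ)
    (j : Fin n) : Prop :=
  ∀ φ : EuclideanSpace ℝ (Fin n) → ℝ, ContDiff ℝ ∞ φ → HasCompactSupport φ → tsupport φ ⊆ X →
    (∫ x in X, g x * fderiv ℝ φ x (EuclideanSpace.single j 1)) = -(∫ x in X, d x * φ x)

lemma norm_le_of_forall_single {A : EuclideanSpace ℝ (Fin n) →L[ℝ] ℝ} {B : ℝ} (hB : 0 ≤ B)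
    (h : ∀ j, |A (EuclideanSpace.single j 1)| ≤ B) : ‖A‖ ≤ n * B := by
  refine A.opNorm_le_bound (by positivity) fun v => ?_
  have hv : v = ∑ j, v j • EuclideanSpace.single j (1 : ℝ) := by
    have := (EuclideanSpace.basisFun (Fin n) ℝ).sum_repr v
    simpa using this.symm
  calc ‖A v‖ = ‖∑ j, v j * A (EuclideanSpace.single j 1)‖ := by
        conv_lhs => rw [hv]
        simp only [map_sum, map_smul, smul_eq_mul]
    _ ≤ ∑ j, ‖v j * A (EuclideanSpace.single j 1)‖ := norm_sum_le _ _
    _ ≤ ∑ _j : Fin n, ‖v‖ * B := by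
        refine Finset.sum_le_sum fun j _ => ?_
        rw [norm_mul]
        gcongr
        · exact PiLp.norm_apply_le v j
        · exact h j
    _ = n * B * ‖v‖ := by simp; ring

/-- The derivative of a mollified function falls on the kernel: it is the function tested with the
derivative of the reflected kernel, as in the definition of the weak derivative. -/
lemma fderiv_convolution_normed_apply {g : EuclideanSpace ℝ (Fin n) → ℝ} (hg : LocallyIntegrable g)
    (φ : ContDiffBump (0 : EuclideanSpace ℝ (Fin n))) (x v : EuclideanSpace ℝ (Fin n)) :
    DifferentiableAt ℝ (convolution (φ.normed volume) g (ContinuousLinearMap.lsmul ℝ ℝ) volume) x ∧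
    fderiv ℝ (convolution (φ.normed volume) g (ContinuousLinearMap.lsmul ℝ ℝ) volume) x v =
      -∫ s, g s * fderiv ℝ (fun y => φ.normed volume (x - y)) s v := by
  have hφ : ContDiff ℝ 1 (φ.normed volume) := φ.contDiff_normed
  have h := φ.hasCompactSupport_normed.hasFDerivAt_convolution_left (ContinuousLinearMap.lsmul ℝ ℝ)
    hφ hg x (μ := volume)
  refine ⟨h.differentiableAt, ?_⟩
  have hce := (φ.hasCompactSupport_normed (μ := volume)).fderiv ℝ |>.convolutionExists_left
    ((ContinuousLinearMap.lsmul ℝ ℝ).precompL (EuclideanSpace ℝ (Fin n)))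
    (hφ.continuous_fderiv one_ne_zero) hg x (μ := volume)
  rw [h.fderiv, convolution_def, ContinuousLinearMap.integral_apply hce, ← integral_neg,
    ← integral_sub_left_eq_self _ volume x]
  refine integral_congr_ae (Eventually.of_forall fun s => ?_)
  have hd : HasFDerivAt (fun y => φ.normed volume (x - y))
      ((fderiv ℝ (φ.normed volume) (x - s)).comp
        (-ContinuousLinearMap.id ℝ (EuclideanSpace ℝ (Fin n)))) s :=
    ((hφ.differentiable one_ne_zero) (x - s)).hasFDerivAt.comp s
      ((hasFDerivAt_id s).const_sub x)
  simp only [hd.fderiv, sub_sub_cancel]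
  simp [ContinuousLinearMap.precompL_apply, mul_comm]

/-- Where the mollification kernel stays inside `X`, the gradient of the mollified function is
controlled by a bound of the weak partial derivatives. -/
lemma norm_fderiv_convolution_normed_le (hXo : IsOpen X)
    {g : EuclideanSpace ℝ (Fin n) → ℝ} (hg : LocallyIntegrable (X.indicator g))
    {d : Fin n → EuclideanSpace ℝ (Fin n) → ℝ} {B : ℝ} (hB : 0 ≤ B)
    (hd : ∀ j, ∀ᵐ x ∂volume.restrict X, |d j x| ≤ B) (hw : ∀ j, IsWeakPartial X g (d j) j)
    (φ : ContDiffBump (0 : EuclideanSpace ℝ (Fin n))) {x : EuclideanSpace ℝ (Fin n)}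
    (hx : Metric.closedBall x φ.rOut ⊆ X) :
    ‖fderiv ℝ (convolution (φ.normed volume) (X.indicator g) (ContinuousLinearMap.lsmul ℝ ℝ)
      volume) x‖ ≤ n * B := by
  refine norm_le_of_forall_single hB fun j => ?_
  rw [(fderiv_convolution_normed_apply hg φ x _).2]
  set χ : EuclideanSpace ℝ (Fin n) → ℝ := fun y => φ.normed volume (x - y) with hχ
  have hχs : Function.support χ ⊆ Metric.closedBall x φ.rOut := by
    intro y hy
    have : x - y ∈ Function.support (φ.normed volume) := hy
    rw [φ.support_normed_eq, mem_ball_zero_iff] at this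
    rw [Metric.mem_closedBall, dist_comm, dist_eq_norm]
    exact this.le
  have hχt : tsupport χ ⊆ Metric.closedBall x φ.rOut :=
    closure_minimal hχs Metric.isClosed_closedBall
  have hχc : HasCompactSupport χ :=
    HasCompactSupport.of_support_subset_isCompact (isCompact_closedBall _ _) hχs
  have hφd : ContDiff ℝ ∞ (φ.normed volume) := φ.contDiff_normed
  have hχd : ContDiff ℝ ∞ χ := hφd.comp (by fun_prop)
  have h1 : ∫ s, X.indicator g s * fderiv ℝ χ s (EuclideanSpace.single j 1) =
      ∫ s in X, g s * fderiv ℝ χ s (EuclideanSpace.single j 1) := by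
    rw [← integral_indicator hXo.measurableSet]
    refine integral_congr_ae (Eventually.of_forall fun s => ?_)
    by_cases hs : s ∈ X <;> simp [hs]
  rw [h1, hw j χ hχd hχc (hχt.trans hx), neg_neg]
  have hχi : Integrable χ := hχd.continuous.integrable_of_hasCompactSupport hχc
  have hχ0 : ∀ y, 0 ≤ χ y := fun y => φ.nonneg_normed _
  have hχ1 : ∫ y, χ y = 1 := by
    rw [hχ, integral_sub_left_eq_self (φ.normed volume) volume x]
    exact φ.integral_normed
  calc |∫ s in X, d j s * χ s| ≤ ∫ s in X, B * χ s := by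
        rw [← Real.norm_eq_abs]
        refine norm_integral_le_of_norm_le (hχi.const_mul B).restrict ?_
        filter_upwards [hd j] with s hs
        rw [norm_mul, Real.norm_of_nonneg (hχ0 s)]
        exact mul_le_mul_of_nonneg_right hs (hχ0 s)
    _ = B * ∫ s in X, χ s := integral_const_mul _ _
    _ ≤ B * 1 := by
        gcongr
        rw [← hχ1]
        exact setIntegral_le_integral hχi (Eventually.of_forall hχ0)
    _ = B := mul_one B

/-- A scalar function with bounded weak partial derivatives is Lipschitz along segments, up to a
null set of end points. -/
lemma exists_ae_lipschitz_of_isWeakPartial (hXo : IsOpen X)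
    {g : EuclideanSpace ℝ (Fin n) → ℝ} (hg : LocallyIntegrable (X.indicator g))
    {d : Fin n → EuclideanSpace ℝ (Fin n) → ℝ} {B : ℝ} (hB : 0 ≤ B)
    (hd : ∀ j, ∀ᵐ x ∂volume.restrict X, |d j x| ≤ B) (hw : ∀ j, IsWeakPartial X g (d j) j) :
    ∃ G : Set (EuclideanSpace ℝ (Fin n)), (∀ᵐ x, x ∈ G) ∧
      ∀ x ∈ G, ∀ y ∈ G, segment ℝ x y ⊆ X → |g x - g y| ≤ n * B * dist x y := by
  let φ : ℕ → ContDiffBump (0 : EuclideanSpace ℝ (Fin n)) := fun k =>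
    ⟨1 / (2 * ((k : ℝ) + 1)), 1 / ((k : ℝ) + 1), by positivity, by
      apply one_div_lt_one_div_of_lt <;> linarith [(Nat.cast_nonneg k : (0 : ℝ) ≤ k)]⟩
  have hφ0 : Tendsto (fun k => (φ k).rOut) atTop (𝓝 0) := tendsto_one_div_add_atTop_nhds_zero_nat
  have hφ2 : ∀ᶠ k in atTop, (φ k).rOut ≤ 2 * (φ k).rIn := Eventually.of_forall fun k => by
    simp only [φ]
    rw [mul_one_div, mul_comm (2 : ℝ), div_mul_cancel_right₀ two_ne_zero, one_div]
  have hconv := ContDiffBump.ae_convolution_tendsto_right_of_locallyIntegrable (μ := volume)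
    hφ0 hφ2 hg
  refine ⟨{x | Tendsto (fun k => convolution ((φ k).normed volume) (X.indicator g)
    (ContinuousLinearMap.lsmul ℝ ℝ) volume x) atTop (𝓝 (X.indicator g x))}, hconv,
    fun x hx y hy hxy => ?_⟩
  rw [mem_ofPred_eq] at hx hy
  -- for small kernels the segment stays far from the complement of `X`, so that the mean value
  -- inequality applies to the mollified functions
  have hcomp : IsCompact (segment ℝ x y) := by
    rw [segment_eq_image']
    exact isCompact_Icc.image (by fun_prop)
  obtain ⟨δ, hδ, hδX⟩ := hcomp.exists_cthickening_subset_open hXo hxy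
  have hlim := ((hx.sub hy).abs)
  rw [indicator_of_mem (hxy (left_mem_segment ℝ x y)),
    indicator_of_mem (hxy (right_mem_segment ℝ x y))] at hlim
  refine le_of_tendsto hlim ?_
  filter_upwards [hφ0.eventually (Iic_mem_nhds hδ)] with k hk
  have hball : ∀ z ∈ segment ℝ x y, Metric.closedBall z (φ k).rOut ⊆ X := fun z hz =>
    (Metric.closedBall_subset_cthickening hz _).trans ((Metric.cthickening_mono hk _).trans hδX)
  have := Convex.norm_image_sub_le_of_norm_fderiv_le (𝕜 := ℝ)
    (fun z _ => (fderiv_convolution_normed_apply hg (φ k) z 0).1)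
    (fun z hz => norm_fderiv_convolution_normed_le hXo hg hB hd hw (φ k) (hball z hz))
    (convex_segment x y) (right_mem_segment ℝ x y) (left_mem_segment ℝ x y)
  rw [dist_eq_norm]
  exact this

lemma exists_tendsto_of_lipschitzOnWith_ball {E F : Type*} [PseudoMetricSpace E]
    [NormedAddCommGroup F] [NormedSpace ℝ F] [FiniteDimensional ℝ F] {A : Set E} {f : E → F}
    {p : E} {r : ℝ} (hr : 0 < r) {C : ℝ≥0} (hf : LipschitzOnWith C f (A ∩ Metric.ball p r)) :
    ∃ y, Tendsto f (𝓝[A] p) (𝓝 y) ∧ (p ∈ A → y = f p) := by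
  obtain ⟨g, hg, hfg⟩ := hf.extend_finite_dimension
  refine ⟨g p, ?_, fun hp => (hfg ⟨hp, Metric.mem_ball_self hr⟩).symm⟩
  refine (hg.continuous.continuousWithinAt (s := A)).tendsto.congr' ?_
  filter_upwards [inter_mem_nhdsWithin A (Metric.ball_mem_nhds p hr)] with x hx
  exact (hfg hx).symm

lemma subset_closure_inter_of_ae (hXo : IsOpen X) {G : Set (EuclideanSpace ℝ (Fin n))}
    (hG : ∀ᵐ x ∂volume.restrict X, x ∈ G) : X ⊆ closure (G ∩ X) := by
  intro x hx
  refine mem_closure_iff.2 fun U hU hxU => ?_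
  have hpos : 0 < volume (U ∩ X) := (hU.inter hXo).measure_pos volume ⟨x, hxU, hx⟩
  rw [ae_restrict_iff' hXo.measurableSet] at hG
  by_contra hne
  refine hpos.ne' (measure_mono_null (fun y hy => ?_) (ae_iff.1 hG))
  exact fun h => hne ⟨y, hy.1, h hy.2, hy.2⟩

/-- A function that is Lipschitz along segments, up to a null set of end points, agrees almost
everywhere with a function that is Lipschitz along segments. -/
lemma exists_ae_eq_lipschitzAlongSegments {F : Type*} [NormedAddCommGroup F] [NormedSpace ℝ F]
    [FiniteDimensional ℝ F] (hXo : IsOpen X) {u : EuclideanSpace ℝ (Fin n) → F} {L : ℝ≥0}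
    {G : Set (EuclideanSpace ℝ (Fin n))} (hG : ∀ᵐ x, x ∈ G)
    (hu : ∀ x ∈ G, ∀ y ∈ G, segment ℝ x y ⊆ X → dist (u x) (u y) ≤ L * dist x y) :
    ∃ w, u =ᵐ[volume.restrict X] w ∧ LipschitzAlongSegments L X w := by
  have hXcl : X ⊆ closure (G ∩ X) := subset_closure_inter_of_ae hXo (ae_restrict_of_ae hG)
  have hlim : ∀ x ∈ X, ∃ y, Tendsto u (𝓝[G ∩ X] x) (𝓝 y) ∧ (x ∈ G ∩ X → y = u x) := by
    intro x hx
    obtain ⟨r, hr, hrX⟩ := Metric.isOpen_iff.1 hXo x hx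
    refine exists_tendsto_of_lipschitzOnWith_ball hr (C := L) (LipschitzOnWith.of_dist_le_mul ?_)
    exact fun y hy z hz => hu y hy.1.1 z hz.1.1
      (((convex_ball x r).segment_subset hy.2 hz.2).trans hrX)
  have hw : ∀ x ∈ X, Tendsto u (𝓝[G ∩ X] x) (𝓝 (extendFrom (G ∩ X) u x)) := fun x hx => by
    obtain ⟨y, hy, -⟩ := hlim x hx
    exact tendsto_extendFrom ⟨y, hy⟩
  refine ⟨extendFrom (G ∩ X) u, ?_, fun x y hxy => ?_⟩
  · filter_upwards [ae_restrict_of_ae hG, ae_restrict_mem hXo.measurableSet] with x hxG hxX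
    obtain ⟨y, hy, hyx⟩ := hlim x hxX
    rw [extendFrom_eq (hXcl hxX) hy, hyx ⟨hxG, hxX⟩]
  · have hx := hxy (left_mem_segment ℝ x y)
    have hy := hxy (right_mem_segment ℝ x y)
    have hcomp : IsCompact (segment ℝ x y) := by
      rw [segment_eq_image']
      exact isCompact_Icc.image (by fun_prop)
    obtain ⟨δ, hδ, hδX⟩ := hcomp.exists_thickening_subset_open hXo hxy
    have hnx : (𝓝[G ∩ X] x).NeBot := mem_closure_iff_nhdsWithin_neBot.1 (hXcl hx)
    have hny : (𝓝[G ∩ X] y).NeBot := mem_closure_iff_nhdsWithin_neBot.1 (hXcl hy)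
    have hnhds : ∀ z ∈ segment ℝ x y, ∀ᶠ z' in 𝓝[G ∩ X] z,
        z' ∈ G ∧ z' ∈ Metric.thickening δ (segment ℝ x y) := fun z hz => by
      filter_upwards [self_mem_nhdsWithin, mem_nhdsWithin_of_mem_nhds
        (Metric.isOpen_thickening.mem_nhds (Metric.self_subset_thickening hδ _ hz))] with z' h1 h2
      exact ⟨h1.1, h2⟩
    have hl : Tendsto (fun q : EuclideanSpace ℝ (Fin n) × EuclideanSpace ℝ (Fin n) =>
        dist (u q.1) (u q.2)) (𝓝[G ∩ X] x ×ˢ 𝓝[G ∩ X] y)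
        (𝓝 (dist (extendFrom (G ∩ X) u x) (extendFrom (G ∩ X) u y))) :=
      ((hw x hx).comp tendsto_fst).dist ((hw y hy).comp tendsto_snd)
    have hr : Tendsto (fun q : EuclideanSpace ℝ (Fin n) × EuclideanSpace ℝ (Fin n) =>
        (L : ℝ) * dist q.1 q.2) (𝓝[G ∩ X] x ×ˢ 𝓝[G ∩ X] y) (𝓝 (L * dist x y)) := by
      refine Tendsto.const_mul _ (Tendsto.dist ?_ ?_)
      · exact tendsto_fst.mono_right nhdsWithin_le_nhds
      · exact tendsto_snd.mono_right nhdsWithin_le_nhds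
    refine le_of_tendsto_of_tendsto hl hr ?_
    filter_upwards [(hnhds x (left_mem_segment ℝ x y)).prod_mk
      (hnhds y (right_mem_segment ℝ x y))] with q hq
    exact hu _ hq.1.1 _ hq.2.1
      ((((convex_segment x y).thickening δ).segment_subset hq.1.2 hq.2.2).trans hδX)

lemma MeasureTheory.MemLp.exists_ae_norm_le {α F : Type*} [MeasurableSpace α] {μ : Measure α}
    [NormedAddCommGroup F] {f : α → F} (hf : MemLp f ⊤ μ) : ∃ B : ℝ≥0, ∀ᵐ x ∂μ, ‖f x‖ ≤ B := by
  have h := hf.2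
  rw [eLpNorm_exponent_top] at h
  refine ⟨(eLpNormEssSup f μ).toNNReal, ?_⟩
  filter_upwards [ae_le_eLpNormEssSup (f := f) (μ := μ)] with x hx
  rw [← ENNReal.coe_toNNReal h.ne, enorm_le_coe] at hx
  exact_mod_cast hx

/-- A function in `W^{1,∞}` agrees almost everywhere with a function that is continuous on the
closure and Lipschitz along segments. -/
theorem MemW1Inf.exists_representative (hXo : IsOpen X) (hXL : HasLipschitzBoundary X)
    {u : EuclideanSpace ℝ (Fin n) → EuclideanSpace ℝ (Fin m)} (hu : MemW1Inf X u) :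
    ∃ (w : EuclideanSpace ℝ (Fin n) → EuclideanSpace ℝ (Fin m)) (L : ℝ≥0),
      u =ᵐ[volume.restrict X] w ∧ ContinuousOn w (closure X) ∧ LipschitzAlongSegments L X w := by
  obtain ⟨hub, D, ⟨-, hD⟩, hDb⟩ := hu
  choose B hB using fun i j => (hDb i j).exists_ae_norm_le
  set B' : ℝ≥0 := ∑ i, ∑ j, B i j with hB'
  have hBB : ∀ i j, B i j ≤ B' := fun i j =>
    (Finset.single_le_sum (f := fun j => B i j) (fun _ _ => zero_le) (Finset.mem_univ j)).trans
      (Finset.single_le_sum (f := fun i => ∑ j, B i j) (fun _ _ => zero_le) (Finset.mem_univ i))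
  have hloc : ∀ i, LocallyIntegrable (X.indicator fun x => u x i) := fun i => by
    have h1 : MemLp (fun x => u x i) ⊤ (volume.restrict X) :=
      (EuclideanSpace.proj (𝕜 := ℝ) i).comp_memLp' hub
    exact ((memLp_indicator_iff_restrict hXo.measurableSet).2 h1).locallyIntegrable le_top
  choose G hG hGL using fun i => exists_ae_lipschitz_of_isWeakPartial hXo (hloc i) B'.2
    (d := fun j x => D x i j) (fun j => by
      filter_upwards [hB i j] with x hx
      exact hx.trans (hBB i j)) (fun j => (hD i j).2)
  obtain ⟨w₀, huw₀, hw₀⟩ := exists_ae_eq_lipschitzAlongSegments (u := u) (L := m * (n * B')) hXo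
    (G := ⋂ i, G i) (by simpa [ae_all_iff] using hG) (fun x hx y hy hxy => by
      rw [dist_eq_norm]
      have h1 : ‖u x - u y‖ ≤ ∑ i, |u x i - u y i| := by
        have hv : u x - u y = ∑ i, (u x i - u y i) • EuclideanSpace.single i (1 : ℝ) := by
          have := (EuclideanSpace.basisFun (Fin m) ℝ).sum_repr (u x - u y)
          simpa using this.symm
        rw [hv]
        refine (norm_sum_le _ _).trans (Finset.sum_le_sum fun i _ => ?_)
        rw [norm_smul]
        simp
      refine h1.trans ?_
      calc ∑ i, |u x i - u y i| ≤ ∑ _i : Fin m, n * B' * dist x y :=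
            Finset.sum_le_sum fun i _ => hGL i x (mem_iInter.1 hx i) y (mem_iInter.1 hy i) hxy
        _ = _ := by simp; ring)
  have hlim : ∀ p ∈ closure X, ∃ y, Tendsto w₀ (𝓝[X] p) (𝓝 y) ∧ (p ∈ X → y = w₀ p) := by
    intro p hp
    obtain ⟨r, hr, C, hC⟩ := exists_ball_lipschitzOnWith hXo hXL hw₀ hp
    exact exists_tendsto_of_lipschitzOnWith_ball hr hC
  have heq : EqOn (extendFrom X w₀) w₀ X := fun x hx => by
    obtain ⟨y, hy, hyx⟩ := hlim x (subset_closure hx)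
    rw [extendFrom_eq (subset_closure hx) hy, hyx hx]
  refine ⟨extendFrom X w₀, m * (n * B'), ?_, ?_, fun x y hxy => ?_⟩
  · filter_upwards [huw₀, ae_restrict_mem hXo.measurableSet] with x hx hxX
    rw [hx, heq hxX]
  · exact continuousOn_extendFrom subset_rfl fun x hx => (hlim x hx).imp fun y hy => hy.1
  · rw [heq (hxy (left_mem_segment ℝ x y)), heq (hxy (right_mem_segment ℝ x y))]
    exact hw₀ x y hxy

/-- The trace is the value of the continuous representative. -/
lemma boundaryTrace_eq (hXo : IsOpen X)
    {u w : EuclideanSpace ℝ (Fin n) → EuclideanSpace ℝ (Fin m)}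
    (hu : MemLp u ⊤ (volume.restrict X)) (huw : u =ᵐ[volume.restrict X] w)
    (hw : ContinuousOn w (closure X)) {x : EuclideanSpace ℝ (Fin n)} (hx : x ∈ closure X) :
    boundaryTrace X u x = w x := by
  refine Tendsto.limUnder_eq (Metric.tendsto_nhds.2 fun ε hε => ?_)
  obtain ⟨δ, hδ, H⟩ := Metric.continuousWithinAt_iff.1 (hw x hx) (ε / 2) (half_pos hε)
  filter_upwards [Ioo_mem_nhdsGT hδ] with r hr
  have hpos : volume (X ∩ Metric.ball x r) ≠ 0 := by
    refine ((hXo.inter Metric.isOpen_ball).measure_pos volume ?_).ne'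
    obtain ⟨y, hy, hyX⟩ := mem_closure_iff.1 hx _ Metric.isOpen_ball (Metric.mem_ball_self hr.1)
    exact ⟨y, hyX, hy⟩
  have hfin : volume (X ∩ Metric.ball x r) ≠ ⊤ :=
    ((measure_mono inter_subset_right).trans_lt measure_ball_lt_top).ne
  have hmem : (⨍ y in X ∩ Metric.ball x r, u y) ∈ Metric.closedBall (w x) (ε / 2) := by
    refine (convex_closedBall _ _).set_average_mem Metric.isClosed_closedBall hpos hfin ?_ ?_
    · filter_upwards [ae_restrict_of_ae_restrict_of_subset inter_subset_left huw,
        ae_restrict_mem (hXo.inter Metric.isOpen_ball).measurableSet] with y hy hyX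
      rw [hy]
      exact (H (subset_closure hyX.1) ((Metric.mem_ball.1 hyX.2).trans hr.2)).le
    · have h1 := hu.mono_measure (Measure.restrict_mono_set volume
        (inter_subset_left : X ∩ Metric.ball x r ⊆ X))
      have : IsFiniteMeasure (volume.restrict (X ∩ Metric.ball x r)) :=
        ⟨by rw [Measure.restrict_apply_univ]; exact hfin.lt_top⟩
      exact h1.integrable le_top
  exact (Metric.mem_closedBall.1 hmem).trans_lt (half_lt_self hε)

/-- A weak Jacobian is almost everywhere the classical Jacobian of a representative that is
Lipschitz along segments. -/
theorem HasWeakJacobian.ae_eq_fderiv (hXo : IsOpen X)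
    {u w : EuclideanSpace ℝ (Fin n) → EuclideanSpace ℝ (Fin m)}
    {D : EuclideanSpace ℝ (Fin n) → Matrix (Fin m) (Fin n) ℝ} (hD : HasWeakJacobian X u D)
    (huw : u =ᵐ[volume.restrict X] w) {L : ℝ≥0} (hw : LipschitzAlongSegments L X w) :
    ∀ᵐ x ∂volume.restrict X, D x = Matrix.of fun i j =>
      fderiv ℝ w x (EuclideanSpace.single j 1) i := by
  have key : ∀ i j, ∀ᵐ x ∂volume.restrict X,
      D x i j = fderiv ℝ w x (EuclideanSpace.single j 1) i := by
    intro i j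
    rw [ae_restrict_iff' hXo.measurableSet, ae_iff]
    refine measure_null_of_locally_null _ fun p hp => ?_
    have hpX : p ∈ X := by by_contra h; exact hp fun h' => absurd h' h
    obtain ⟨r, hr, hrX⟩ := Metric.isOpen_iff.1 hXo p hpX
    have hwi : LipschitzOnWith L (fun x => w x i) (Metric.ball p r) :=
      LipschitzOnWith.of_dist_le_mul fun x hx y hy => by
        have h1 := (hw.lipschitzOnWith_of_convex (convex_ball p r) hrX).dist_le_mul x hx y hy
        refine le_trans ?_ h1
        rw [Real.dist_eq, dist_eq_norm]
        exact PiLp.norm_apply_le (w x - w y) i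
    obtain ⟨f, hf, hwf⟩ := hwi.extend_real
    set v : EuclideanSpace ℝ (Fin n) := EuclideanSpace.single j 1
    have hDl : LocallyIntegrableOn (fun x => D x i j) (Metric.ball p r) :=
      (hD.2 i j).1.mono_set hrX
    have hfl : LocallyIntegrable fun x => lineDeriv ℝ f x v := hf.locallyIntegrable_lineDeriv v
    have hzero := Metric.isOpen_ball.ae_eq_zero_of_integral_contDiff_smul_eq_zero
      (μ := volume) (hDl.sub (hfl.locallyIntegrableOn _)) (fun φ hφ hφc hφs => by
        have hφX := hφs.trans hrX
        have hφ0 : ∀ x, x ∉ Metric.ball p r → φ x = 0 := fun x hx =>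
          image_eq_zero_of_notMem_tsupport fun h => hx (hφs h)
        have hφ0' : ∀ x, x ∉ Metric.ball p r → fderiv ℝ φ x = 0 := fun x hx => by
          by_contra h0
          exact hx (hφs (support_fderiv_subset ℝ h0))
        obtain ⟨C, hC⟩ := hφ.lipschitzWith_of_hasCompactSupport hφc (by simp)
        have i1 : Integrable fun x => φ x * D x i j := by
          have h1 : IntegrableOn (fun x => D x i j) (tsupport φ) :=
            ((hD.2 i j).1.mono_set hφX).integrableOn_isCompact hφc
          have h2 := h1.continuousOn_mul hφ.continuous.continuousOn hφc
          refine (integrableOn_iff_integrable_of_support_subset fun x hx => ?_).1 h2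
          exact subset_tsupport φ fun h0 => hx (by simp [h0])
        have i2 : Integrable fun x => φ x * lineDeriv ℝ f x v :=
          hfl.integrable_smul_left_of_hasCompactSupport hφ.continuous hφc
        have e1 : ∫ x, φ x * D x i j = ∫ x in X, D x i j * φ x := by
          rw [← setIntegral_eq_integral_of_forall_compl_eq_zero (s := X) fun x hx => by
            rw [hφ0 x fun h => hx (hrX h), zero_mul]]
          exact integral_congr_ae (Eventually.of_forall fun x => mul_comm _ _)
        have e2 : ∫ x, φ x * lineDeriv ℝ f x v = -∫ x in X, u x i * fderiv ℝ φ x v := by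
          have h1 := LipschitzWith.integral_lineDeriv_mul_eq (μ := volume) hf hC hφc v
          have h2 : ∫ x, φ x * lineDeriv ℝ f x v = ∫ x, lineDeriv ℝ φ x (-v) * f x := by
            rw [← h1]
            exact integral_congr_ae (Eventually.of_forall fun x => mul_comm _ _)
          rw [h2, ← integral_neg, ← setIntegral_eq_integral_of_forall_compl_eq_zero (s := X)]
          · refine integral_congr_ae ?_
            filter_upwards [huw] with x hx
            rw [(hφ.differentiable (by simp) x).lineDeriv_eq_fderiv, map_neg]
            by_cases hxb : x ∈ Metric.ball p r
            · rw [hx, ← hwf hxb]; ring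
            · rw [hφ0' x hxb]; simp
          · intro x hx
            rw [(hφ.differentiable (by simp) x).lineDeriv_eq_fderiv, hφ0' x fun h => hx (hrX h)]
            simp
        have e3 : ∫ x, φ x • ((fun x => D x i j) - fun x => lineDeriv ℝ f x v) x =
            (∫ x, φ x * D x i j) - ∫ x, φ x * lineDeriv ℝ f x v := by
          rw [← integral_sub i1 i2]
          exact integral_congr_ae (Eventually.of_forall fun x => by
            simp only [Pi.sub_apply, smul_eq_mul]; ring)
        rw [e3, e1, e2, (hD.2 i j).2 φ hφ hφc hφX]
        ring)
    have hdw := hw.ae_differentiableAt (μ := volume) hXo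
    rw [ae_restrict_iff' hXo.measurableSet] at hdw
    have hdf := hf.ae_differentiableAt (μ := volume)
    refine ⟨{a | ¬(a ∈ X → D a i j = fderiv ℝ w a (EuclideanSpace.single j 1) i)} ∩
      Metric.ball p r, inter_mem self_mem_nhdsWithin
        (mem_nhdsWithin_of_mem_nhds (Metric.ball_mem_nhds p hr)), ?_⟩
    have hall : ∀ᵐ x, x ∈ Metric.ball p r →
        D x i j = fderiv ℝ w x (EuclideanSpace.single j 1) i := by
      filter_upwards [hzero, hdw, hdf] with x h1 h2 h3 hxb
      have h4 : D x i j = lineDeriv ℝ f x v := sub_eq_zero.1 (h1 hxb)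
      have h5 : HasFDerivAt (fun y => w y i)
          ((EuclideanSpace.proj (𝕜 := ℝ) i).comp (fderiv ℝ w x)) x :=
        (EuclideanSpace.proj (𝕜 := ℝ) i).hasFDerivAt.comp x (h2 (hrX hxb)).hasFDerivAt
      have h6 : f =ᶠ[𝓝 x] fun y => w y i := by
        filter_upwards [Metric.isOpen_ball.mem_nhds hxb] with y hy
        exact (hwf hy).symm
      rw [h4, h3.lineDeriv_eq_fderiv, h6.fderiv_eq, h5.fderiv]
      rfl
    refine measure_mono_null (fun y hy => ?_) (ae_iff.1 hall)
    exact fun h => hy.1 fun _ => h hy.2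
  have h2 : ∀ᵐ x ∂volume.restrict X, ∀ i j,
      D x i j = fderiv ℝ w x (EuclideanSpace.single j 1) i :=
    ae_all_iff.2 fun i => ae_all_iff.2 fun j => key i j
  filter_upwards [h2] with x hx
  ext i j
  exact hx i j

end Sobolev

/-! ### The chain rule for test functions that are differentiable relative to a set -/

section ChainRule

/-- A mean value inequality for a function whose right difference quotients are bounded close to
every point; no derivative is required to exist. -/
lemma norm_image_sub_le_of_eventually_right {F : Type*} [NormedAddCommGroup F] {g : ℝ → F} {c : ℝ}
    (hg : ContinuousOn g (Icc 0 1))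
    (h : ∀ t ∈ Ico (0 : ℝ) 1, ∀ᶠ z in 𝓝[>] t, ‖g z - g t‖ ≤ c * (z - t)) :
    ‖g 1 - g 0‖ ≤ c := by
  refine le_of_forall_pos_le_add fun ε hε => ?_
  have key := image_norm_le_of_liminf_right_slope_norm_lt_deriv_boundary
    (f := fun t => g t - g 0) (f' := fun _ => c) (B := fun t => (c + ε) * t) (B' := fun _ => c + ε)
    (hg.sub continuousOn_const) (fun t ht r hr => ?_) (by simp) (by fun_prop)
    (fun t _ => by simpa using ((hasDerivAt_id t).const_mul (c + ε)).hasDerivWithinAt)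
    (fun t _ _ => by linarith) (right_mem_Icc.2 zero_le_one)
  · simpa using key
  · refine Eventually.frequently ?_
    filter_upwards [h t ht, self_mem_nhdsWithin] with z hz hzt
    have hzt : 0 < z - t := sub_pos.2 hzt
    rw [slope_def_field, div_lt_iff₀ hzt]
    have h1 := norm_sub_norm_le (g z - g 0) (g t - g 0)
    rw [sub_sub_sub_cancel_right] at h1
    simp only [Function.comp_apply]
    nlinarith

variable {E V F : Type*} [NormedAddCommGroup E] [NormedSpace ℝ E] [NormedAddCommGroup V]
  [NormedSpace ℝ V] [NormedAddCommGroup F] [NormedSpace ℝ F] {X : Set E} {s : Set (E × V)}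
  {θ : E × V → F} {θ' : E × V → E × V →L[ℝ] F} {w : E → V}

lemma IsC1On.continuousOn {E F : Type*} [NormedAddCommGroup E] [NormedSpace ℝ E]
    [NormedAddCommGroup F] [NormedSpace ℝ F] {s : Set E} {f : E → F} {f' : E → E →L[ℝ] F}
    (h : IsC1On s f f') : ContinuousOn f s :=
  fun p hp => (h.hasFDerivWithinAt p hp).continuousWithinAt

/-- A test function composed with a function that is Lipschitz along segments is again Lipschitz
along segments: its difference quotients along a segment are locally bounded by the derivative of
the test function, however thin the set on which the latter is defined. -/
lemma IsC1On.lipschitzAlongSegments (hθ : IsC1On s θ θ')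
    (hXc : IsCompact (closure X)) (hw : ContinuousOn w (closure X))
    (hws : ∀ x ∈ closure X, (x, w x) ∈ s) {L : ℝ≥0} (hL : LipschitzAlongSegments L X w) :
    ∃ L', LipschitzAlongSegments L' X fun x => θ (x, w x) := by
  have hgraph : ContinuousOn (fun x => (x, w x)) (closure X) := continuousOn_id.prodMk hw
  obtain ⟨M, hM⟩ := hXc.exists_bound_of_continuousOn (hθ.continuousOn_deriv.comp hgraph hws)
  set M' := M.toNNReal
  have hM' : ∀ x ∈ closure X, ‖θ' (x, w x)‖ ≤ M' := fun x hx =>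
    (hM x hx).trans (Real.le_coe_toNNReal M)
  refine ⟨(M' + 1) * (1 + L), fun x y hxy => ?_⟩
  set c : ℝ → E := fun t => x + t • (y - x) with hc
  have hcc : Continuous c := by fun_prop
  have hcX : ∀ t ∈ Icc (0 : ℝ) 1, c t ∈ X := fun t ht => hxy (by
    rw [segment_eq_image']; exact ⟨t, ht, rfl⟩)
  have hwc : ContinuousOn (fun t => (c t, w (c t))) (Icc 0 1) :=
    hgraph.comp hcc.continuousOn fun t ht => subset_closure (hcX t ht)
  have hcd : ∀ a b, ‖c a - c b‖ = |a - b| * dist x y := fun a b => by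
    rw [hc, add_sub_add_left_eq_sub, ← sub_smul, norm_smul, dist_comm x,
      dist_eq_norm y x, Real.norm_eq_abs]
  have key := norm_image_sub_le_of_eventually_right (g := fun t => θ (c t, w (c t)))
    (c := (M' + 1) * ((1 + L) * dist x y))
    (hθ.continuousOn.comp hwc fun t ht => hws _ (subset_closure (hcX t ht))) (fun t ht => ?_)
  · simp only [hc, one_smul, zero_smul, add_zero, add_sub_cancel] at key
    rw [dist_comm, dist_eq_norm]
    refine key.trans (le_of_eq ?_)
    push_cast
    ring
  · have htI : t ∈ Icc (0 : ℝ) 1 := Ico_subset_Icc_self ht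
    have hq := hθ.hasFDerivWithinAt _ (hws _ (subset_closure (hcX t htI)))
    have hlo := hq.isLittleO.def one_pos
    have htend : Tendsto (fun z => (c z, w (c z))) (𝓝[>] t) (𝓝[s] (c t, w (c t))) := by
      have hIcc : Icc (0 : ℝ) 1 ∈ 𝓝[>] t :=
        mem_of_superset (Ioc_mem_nhdsGT ht.2) fun z hz => ⟨ht.1.trans hz.1.le, hz.2⟩
      refine tendsto_nhdsWithin_iff.2 ⟨?_, ?_⟩
      · exact (hwc t htI).tendsto.mono_left (nhdsWithin_le_of_mem hIcc)
      · filter_upwards [hIcc] with z hz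
        exact hws _ (subset_closure (hcX z hz))
    filter_upwards [htend.eventually hlo, Ioc_mem_nhdsGT ht.2] with z hz hzt
    have hzI : z ∈ Icc (0 : ℝ) 1 := ⟨ht.1.trans hzt.1.le, hzt.2⟩
    have hseg : segment ℝ (c z) (c t) ⊆ X := by
      have : segment ℝ (c z) (c t) ⊆ segment ℝ x y := by
        refine (convex_segment x y).segment_subset ?_ ?_ <;> rw [segment_eq_image']
        exacts [⟨z, hzI, rfl⟩, ⟨t, htI, rfl⟩]
      exact this.trans hxy
    have hd : ‖(c z, w (c z)) - (c t, w (c t))‖ ≤ (1 + L) * ((z - t) * dist x y) := by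
      have h1 : ‖c z - c t‖ = (z - t) * dist x y := by
        rw [hcd, abs_of_pos (sub_pos.2 hzt.1)]
      have h2 : ‖w (c z) - w (c t)‖ ≤ L * ((z - t) * dist x y) := by
        have := hL _ _ hseg
        rwa [dist_eq_norm, dist_eq_norm, h1] at this
      have h0 : 0 ≤ (z - t) * dist x y := mul_nonneg (sub_nonneg.2 hzt.1.le) dist_nonneg
      rw [Prod.mk_sub_mk, Prod.norm_mk, h1]
      refine max_le ?_ (h2.trans ?_)
      · nlinarith [mul_nonneg L.2 h0]
      · nlinarith
    set δ := (c z, w (c z)) - (c t, w (c t))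
    have h3 : ‖θ' (c t, w (c t)) δ‖ ≤ M' * ‖δ‖ :=
      (ContinuousLinearMap.le_opNorm _ _).trans
        (by gcongr; exact hM' _ (subset_closure (hcX t htI)))
    calc ‖θ (c z, w (c z)) - θ (c t, w (c t))‖
        ≤ ‖θ (c z, w (c z)) - θ (c t, w (c t)) - θ' (c t, w (c t)) δ‖ + ‖θ' (c t, w (c t)) δ‖ := by
          simpa using norm_add_le (θ (c z, w (c z)) - θ (c t, w (c t)) - θ' (c t, w (c t)) δ)
            (θ' (c t, w (c t)) δ)
      _ ≤ 1 * ‖δ‖ + M' * ‖δ‖ := add_le_add hz h3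
      _ = (M' + 1) * ‖δ‖ := by ring
      _ ≤ (M' + 1) * ((1 + L) * ((z - t) * dist x y)) := by gcongr
      _ = _ := by ring

/-- The chain rule. Differentiability of `θ` relative to `s` suffices, since the graph of `w`
over `X` stays in `s`. -/
lemma IsC1On.hasFDerivAt_comp_graph (hθ : IsC1On s θ θ') (hXo : IsOpen X)
    (hws : ∀ x ∈ closure X, (x, w x) ∈ s) {x : E} (hx : x ∈ X) (hd : DifferentiableAt ℝ w x) :
    HasFDerivAt (fun x => θ (x, w x))
      ((θ' (x, w x)).comp ((ContinuousLinearMap.id ℝ E).prod (fderiv ℝ w x))) x := by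
  have h1 : HasFDerivWithinAt (fun x => (x, w x))
      ((ContinuousLinearMap.id ℝ E).prod (fderiv ℝ w x)) X x :=
    ((hasFDerivAt_id x).prodMk hd.hasFDerivAt).hasFDerivWithinAt
  exact ((hθ.hasFDerivWithinAt _ (hws x (subset_closure hx))).comp x h1
    fun y hy => hws y (subset_closure hy)).hasFDerivAt (hXo.mem_nhds hx)

/-- The divergence of a composition, by the chain rule. -/
lemma sum_comp_prod_single_eq {n m : ℕ}
    (A : EuclideanSpace ℝ (Fin n) × EuclideanSpace ℝ (Fin m) →L[ℝ] EuclideanSpace ℝ (Fin n))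
    (B : EuclideanSpace ℝ (Fin n) →L[ℝ] EuclideanSpace ℝ (Fin m)) :
    ∑ i, A (EuclideanSpace.single i 1, B (EuclideanSpace.single i 1)) i =
      divX A + Matrix.trace
        ((Matrix.of fun i j => B (EuclideanSpace.single j 1) i : Matrix (Fin m) (Fin n) ℝ) *
          jacY A) := by
  have h1 : ∀ i : Fin n, A (EuclideanSpace.single i 1, B (EuclideanSpace.single i 1)) i =
      A (EuclideanSpace.single i 1, 0) i +
        ∑ j, B (EuclideanSpace.single i 1) j * A (0, EuclideanSpace.single j 1) i := by
    intro i
    have hB : B (EuclideanSpace.single i 1) =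
        ∑ j, B (EuclideanSpace.single i 1) j • EuclideanSpace.single j (1 : ℝ) := by
      have := (EuclideanSpace.basisFun (Fin m) ℝ).sum_repr (B (EuclideanSpace.single i 1))
      simpa using this.symm
    have hz : ((0 : EuclideanSpace ℝ (Fin n)), B (EuclideanSpace.single i 1)) =
        ∑ j, B (EuclideanSpace.single i 1) j •
          ((0 : EuclideanSpace ℝ (Fin n)), EuclideanSpace.single j (1 : ℝ)) := by
      conv_lhs => rw [hB]
      simp only [Prod.smul_mk, smul_zero, Prod.ext_iff, Prod.fst_sum, Prod.snd_sum]
      simp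
    have hs : ((EuclideanSpace.single i (1 : ℝ) : EuclideanSpace ℝ (Fin n)),
        B (EuclideanSpace.single i 1)) =
        (EuclideanSpace.single i (1 : ℝ), 0) + (0, B (EuclideanSpace.single i 1)) := by simp
    rw [hs, map_add, hz, map_sum]
    simp only [map_smul, PiLp.add_apply, WithLp.ofLp_sum, Finset.sum_apply, PiLp.smul_apply,
      smul_eq_mul]
  simp only [h1, Finset.sum_add_distrib, divX, jacY, Matrix.trace, Matrix.diag, Matrix.mul_apply,
    Matrix.of_apply]
  rw [Finset.sum_comm (s := (Finset.univ : Finset (Fin n)))]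

end ChainRule

/-! ### The weak formulation of `v = Du` -/

section Weak

variable {n m : ℕ} {X : Set (EuclideanSpace ℝ (Fin n))}
  {u : EuclideanSpace ℝ (Fin n) → EuclideanSpace ℝ (Fin m)}

lemma MemW1Inf.hasWeakJacobian_weakJacobian (hu : MemW1Inf X u) :
    HasWeakJacobian X u (weakJacobian X u) := by
  obtain ⟨-, D, hD, -⟩ := hu
  exact Classical.epsilon_spec (p := fun D => HasWeakJacobian X u D) ⟨D, hD⟩

/-- The divergence theorem for the vector field `x ↦ θ (x, u x)`. -/
theorem MemW1Inf.integral_divergence_comp (hXo : IsOpen X) (hXb : Bornology.IsBounded X)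
    (hXL : HasLipschitzBoundary X) (hu : MemW1Inf X u) {Y : Set (EuclideanSpace ℝ (Fin m))}
    (huY : ∀ᵐ x ∂volume.restrict X, u x ∈ Y)
    {θ : EuclideanSpace ℝ (Fin n) × EuclideanSpace ℝ (Fin m) → EuclideanSpace ℝ (Fin n)}
    {θ' : EuclideanSpace ℝ (Fin n) × EuclideanSpace ℝ (Fin m) →
      EuclideanSpace ℝ (Fin n) × EuclideanSpace ℝ (Fin m) →L[ℝ] EuclideanSpace ℝ (Fin n)}
    (hθ : IsC1On (closure X ×ˢ closure Y) θ θ')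
    {D : EuclideanSpace ℝ (Fin n) → Matrix (Fin m) (Fin n) ℝ} (hD : HasWeakJacobian X u D) :
    ∫ x in X, (divX (θ' (x, u x)) + Matrix.trace (D x * jacY (θ' (x, u x)))) =
      ∫ x, inner ℝ (θ (x, boundaryTrace X u x)) (outwardUnitNormal X x) ∂surfaceMeasure X := by
  obtain ⟨w, L, huw, hwc, hwL⟩ := hu.exists_representative hXo hXL
  -- `w` takes its values in `Y` on a subset of full measure, which is dense in `X`
  have hwY : ∀ x ∈ closure X, w x ∈ closure Y := by
    have hG : ∀ᵐ x ∂volume.restrict X, x ∈ w ⁻¹' Y := by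
      filter_upwards [huw, huY] with x hx hxY
      rw [mem_preimage, ← hx]
      exact hxY
    have hcl : closure X = closure (w ⁻¹' Y ∩ X) :=
      subset_antisymm (closure_minimal (subset_closure_inter_of_ae hXo hG) isClosed_closure)
        (closure_mono inter_subset_right)
    rw [hcl] at hwc ⊢
    exact MapsTo.closure_of_continuousOn (fun x hx => hx.1) hwc
  have hws : ∀ x ∈ closure X, (x, w x) ∈ closure X ×ˢ closure Y := fun x hx => ⟨hx, hwY x hx⟩
  obtain ⟨L', hL'⟩ := hθ.lipschitzAlongSegments hXb.isCompact_closure hwc hws hwL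
  have hfc : ContinuousOn (fun x => θ (x, w x)) (closure X) :=
    hθ.continuousOn.comp (continuousOn_id.prodMk hwc) hws
  have hGG := fun i : Fin n => integral_fderiv_eq_integral_surfaceMeasure hXo hXb hXL
    (f := fun x => θ (x, w x) i) (L := L')
    ((EuclideanSpace.proj (𝕜 := ℝ) i).continuous.comp_continuousOn hfc)
    (fun x y hxy => by
      refine le_trans ?_ (hL' x y hxy)
      rw [Real.dist_eq, dist_eq_norm]
      exact PiLp.norm_apply_le (θ (x, w x) - θ (y, w y)) i) (EuclideanSpace.single i 1)
  have hint : ∀ᵐ x ∂volume.restrict X,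
      divX (θ' (x, u x)) + Matrix.trace (D x * jacY (θ' (x, u x))) =
        ∑ i, fderiv ℝ (fun x => θ (x, w x) i) x (EuclideanSpace.single i 1) := by
    filter_upwards [huw, hD.ae_eq_fderiv hXo huw hwL, hwL.ae_differentiableAt (μ := volume) hXo,
      ae_restrict_mem hXo.measurableSet] with x hx hDx hdx hxX
    rw [hx, hDx, ← sum_comp_prod_single_eq]
    refine Finset.sum_congr rfl fun i _ => ?_
    have h1 := (EuclideanSpace.proj (𝕜 := ℝ) i).hasFDerivAt.comp x
      (hθ.hasFDerivAt_comp_graph hXo hws hxX hdx)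
    have h2 : HasFDerivAt (fun x => θ (x, w x) i) _ x := h1
    rw [h2.fderiv]
    rfl
  have hbd : ∀ᵐ x ∂surfaceMeasure X,
      inner ℝ (θ (x, boundaryTrace X u x)) (outwardUnitNormal X x) =
        ∑ i, θ (x, w x) i * inner ℝ (EuclideanSpace.single i (1 : ℝ)) (outwardUnitNormal X x) := by
    have hσ : ∀ᵐ x ∂surfaceMeasure X, x ∈ frontier X :=
      ae_restrict_mem isClosed_frontier.measurableSet
    filter_upwards [hσ] with x hx
    rw [boundaryTrace_eq hXo hu.1 huw hwc (frontier_subset_closure hx), PiLp.inner_apply]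
    refine Finset.sum_congr rfl fun i _ => ?_
    rw [EuclideanSpace.inner_single_left]
    simp [mul_comm]
  rw [integral_congr_ae hint, integral_congr_ae hbd, integral_finsetSum _ fun i _ => (hGG i).1,
    integral_finsetSum _ fun i _ => (hGG i).2.1]
  exact Finset.sum_congr rfl fun i _ => (hGG i).2.2

lemma hasFDerivAt_mul_smul_single {φ : EuclideanSpace ℝ (Fin n) → ℝ} (hφ : Differentiable ℝ φ)
    (i : Fin m) (j : Fin n) (p : EuclideanSpace ℝ (Fin n) × EuclideanSpace ℝ (Fin m)) :
    HasFDerivAt (fun p : EuclideanSpace ℝ (Fin n) × EuclideanSpace ℝ (Fin m) =>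
        (φ p.1 * p.2 i) • (EuclideanSpace.single j (1 : ℝ) : EuclideanSpace ℝ (Fin n)))
      ((φ p.1 • (EuclideanSpace.proj (𝕜 := ℝ) i).comp (ContinuousLinearMap.snd ℝ _ _) +
        p.2 i • (fderiv ℝ φ p.1).comp (ContinuousLinearMap.fst ℝ _ _)).smulRight
          (EuclideanSpace.single j (1 : ℝ))) p := by
  have h1 : HasFDerivAt (fun p : EuclideanSpace ℝ (Fin n) × EuclideanSpace ℝ (Fin m) => φ p.1)
      ((fderiv ℝ φ p.1).comp (ContinuousLinearMap.fst ℝ _ _)) p :=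
    (hφ p.1).hasFDerivAt.comp p hasFDerivAt_fst
  have h2 : HasFDerivAt (fun p : EuclideanSpace ℝ (Fin n) × EuclideanSpace ℝ (Fin m) => p.2 i)
      ((EuclideanSpace.proj (𝕜 := ℝ) i).comp (ContinuousLinearMap.snd ℝ _ _)) p :=
    (EuclideanSpace.proj (𝕜 := ℝ) i).hasFDerivAt.comp p hasFDerivAt_snd
  exact (h1.mul h2).smul_const _

/-- Testing with `θ (x, y) = φ x * y i • e j`, for `φ` supported in `X`, shows that `v` is a weak
Jacobian of `u`. -/
theorem hasWeakJacobian_of_forall_isC1On (hXo : IsOpen X) (hXb : Bornology.IsBounded X)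
    (Y : Set (EuclideanSpace ℝ (Fin m))) (hu : MemLp u ⊤ (volume.restrict X))
    {v : EuclideanSpace ℝ (Fin n) → Matrix (Fin m) (Fin n) ℝ} (hv : MemLInfMatrix X v)
    (H : ∀ (θ : EuclideanSpace ℝ (Fin n) × EuclideanSpace ℝ (Fin m) → EuclideanSpace ℝ (Fin n))
      (θ' : EuclideanSpace ℝ (Fin n) × EuclideanSpace ℝ (Fin m) →
        EuclideanSpace ℝ (Fin n) × EuclideanSpace ℝ (Fin m) →L[ℝ] EuclideanSpace ℝ (Fin n)),
      IsC1On (closure X ×ˢ closure Y) θ θ' →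
      (∫ x in X, (divX (θ' (x, u x)) + Matrix.trace (v x * jacY (θ' (x, u x))))) -
        (∫ x, inner ℝ (θ (x, boundaryTrace X u x)) (outwardUnitNormal X x) ∂surfaceMeasure X)
        = 0) : HasWeakJacobian X u v := by
  have hfin : IsFiniteMeasure (volume.restrict X) :=
    ⟨by rw [Measure.restrict_apply_univ]; exact hXb.measure_lt_top⟩
  refine ⟨IntegrableOn.locallyIntegrableOn (hu.integrable le_top), fun i j =>
    ⟨IntegrableOn.locallyIntegrableOn ((hv i j).integrable le_top), fun φ hφ hφc hφX => ?_⟩⟩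
  have hφd : Differentiable ℝ φ := hφ.differentiable (by simp)
  have hφ' : Continuous (fderiv ℝ φ) := hφ.continuous_fderiv (by simp)
  have h := H _ _ ⟨fun p _ => (hasFDerivAt_mul_smul_single hφd i j p).hasFDerivWithinAt, by
    refine Continuous.continuousOn ?_
    have := hφ.continuous
    fun_prop⟩
  have hσ : ∀ᵐ x ∂surfaceMeasure X, x ∈ frontier X :=
    ae_restrict_mem isClosed_frontier.measurableSet
  have hb : ∫ x, inner ℝ ((φ x * boundaryTrace X u x i) •
      (EuclideanSpace.single j (1 : ℝ) : EuclideanSpace ℝ (Fin n))) (outwardUnitNormal X x)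
        ∂surfaceMeasure X = 0 := by
    refine integral_eq_zero_of_ae ?_
    filter_upwards [hσ] with x hx
    have hxX : x ∉ X := (hXo.frontier_eq ▸ hx).2
    rw [image_eq_zero_of_notMem_tsupport fun h => hxX (hφX h)]
    simp
  rw [hb, sub_zero] at h
  have hui : MemLp (fun x => u x i) ⊤ (volume.restrict X) :=
    (EuclideanSpace.proj (𝕜 := ℝ) i).comp_memLp' hu
  obtain ⟨M₁, hM₁⟩ := hφc.exists_bound_of_continuous hφ.continuous
  have hφdc : HasCompactSupport fun x => fderiv ℝ φ x (EuclideanSpace.single j 1) :=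
    hφc.fderiv_apply (𝕜 := ℝ) _
  have hφdc' : Continuous fun x => fderiv ℝ φ x (EuclideanSpace.single j 1) := by fun_prop
  obtain ⟨M₂, hM₂⟩ := hφdc.exists_bound_of_continuous hφdc'
  have i1 : IntegrableOn (fun x => u x i * fderiv ℝ φ x (EuclideanSpace.single j 1)) X :=
    (hui.integrable le_top).mul_bdd hφdc'.aestronglyMeasurable (Eventually.of_forall hM₂)
  have i2 : IntegrableOn (fun x => v x i j * φ x) X :=
    ((hv i j).integrable le_top).mul_bdd hφ.continuous.aestronglyMeasurable
      (Eventually.of_forall hM₁)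
  rw [eq_neg_iff_add_eq_zero, ← integral_add i1 i2, ← h]
  refine integral_congr_ae (Eventually.of_forall fun x => ?_)
  simp only [divX, jacY, Matrix.trace, Matrix.diag, Matrix.mul_apply, Matrix.of_apply]
  simp [PiLp.single_apply]
  rw [Finset.sum_eq_single i (fun k _ hk => by simp [Ne.symm hk]) (by simp)]
  simp [PiLp.single_apply]

end Weak

theorem mainTheorem2 {n m : ℕ}
    (X : Set (EuclideanSpace ℝ (Fin n))) (hXo : IsOpen X) (hXb : Bornology.IsBounded X)
    (hXL : HasLipschitzBoundary X)
    (Y : Set (EuclideanSpace ℝ (Fin m)))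
    (u : EuclideanSpace ℝ (Fin n) → EuclideanSpace ℝ (Fin m)) (hu : MemW1Inf X u)
    (huY : ∀ᵐ x ∂volume.restrict X, u x ∈ Y)
    (v : EuclideanSpace ℝ (Fin n) → Matrix (Fin m) (Fin n) ℝ) (hv : MemLInfMatrix X v) :
    (∀ᵐ x ∂volume.restrict X, v x = weakJacobian X u x) ↔
      ∀ (θ : EuclideanSpace ℝ (Fin n) × EuclideanSpace ℝ (Fin m) → EuclideanSpace ℝ (Fin n))
        (θ' : EuclideanSpace ℝ (Fin n) × EuclideanSpace ℝ (Fin m) →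
          EuclideanSpace ℝ (Fin n) × EuclideanSpace ℝ (Fin m) →L[ℝ] EuclideanSpace ℝ (Fin n)),
        IsC1On (closure X ×ˢ closure Y) θ θ' →
        (∫ x in X, (divX (θ' (x, u x)) + Matrix.trace (v x * jacY (θ' (x, u x))))) -
          (∫ x, inner ℝ (θ (x, boundaryTrace X u x)) (outwardUnitNormal X x) ∂surfaceMeasure X)
          = 0 := by
  constructor
  · intro h θ θ' hθ
    rw [← hu.integral_divergence_comp hXo hXb hXL huY hθ hu.hasWeakJacobian_weakJacobian, sub_eq_zero]
    refine integral_congr_ae ?_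
    filter_upwards [h] with x hx
    rw [hx]
  · intro H
    obtain ⟨w, L, huw, -, hwL⟩ := hu.exists_representative hXo hXL
    have hvD := hasWeakJacobian_of_forall_isC1On hXo hXb Y hu.1 hv H
    filter_upwards [hvD.ae_eq_fderiv hXo huw hwL,
      hu.hasWeakJacobian_weakJacobian.ae_eq_fderiv hXo huw hwL] with x h1 h2
    rw [h1, h2]
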